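/- **Setting.** Let $N$ be odd and consider a chain of qubits with sites $1,\dots,N$. A unitary $U$ is *short-range entangled with range $\xi$* if, for all $k$, conjugation $A\mapsto U^\dagger AU$ maps operators supported on $\{\le k\}$ to operators supported on $\{\le k+\xi\}$, and operators supported on $\{>k\}$ to operators supported on $\{>k-\xi\}$. Let $|\Phi\rangle=U|+\rangle\cdots|+\rangle$ for such a $U$, and let $|\Phi\rangle$ be invariant under $g_0=Z_1X_2X_4\cdots X_{N-1}Z_N$ and $g_1=X_1X_3\cdots X_N$. Put $\mathcal K_{\ge k}=Z_kX_{k+1}X_{k+3}\cdots X_{N-1}Z_N$ for $k$ odd, $\mathcal K_{\ge k}=Z_kX_{k+1}X_{k+3}\cdots X_N$ for $k$ even, and $\mathcal K_{k,l}=Z_kX_{k+1}X_{k+3}\cdots X_{l-1}Z_l$ for $l-k\ge 0$ even ($\mathcal K_{k,k}=1$). Fix a region of sites $a,\dots,a+n$ with $1\le a$, $a+n<N$, and $n$ even, $n>2\xi$. Suppose that on the sites of the region with the parity of $a$ the string order is translation invariant, $\langle\mathcal K_{\ge k}\rangle=\mu$ and $\langle\mathcal K_{k,l}\rangle=\langle\mathcal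 K(l-k)\rangle$, and that it is non-zero, $\mu\neq0$ (cluster phase). For an even spacing $\Delta>0$ and $m$ with $m\Delta=n$, a logical rotation by $\beta$ (about the $z$-axis if $a$ is odd, about the $x$-axis if $a$ is even) is split into $m$ symmetry-breaking measurements at the sites $a+k\Delta$, $0\le k<m$, each with angle $\gamma=\beta/(m\mu)$. For odd $a$ let $$M_k=\begin{pmatrix}\cos\gamma&-\sin\gamma\,\mathcal K_{\ge a+k\Delta}&0\\ \sin\gamma\,\mathcal K_{\ge a+k\Delta}&\cos\gamma&0\\0&0&1\end{pmatrix};$$ for even $a$ let $M_k$ be the corresponding matrix with the rotation block in the last two rows and columns and the entry $1$ in the upper left corner. Let $M=\langle\prod_{k<m}M_k\rangle$ (entrywise expectation value in $|\Phi\rangle$), let $R$ be the matrix of the ideal rotation by $\beta$, and let $\mathcal D_m(\Delta)=\sqrt{2\,\mathrm{Tr}[(M-R)^\dagger(M-R)]}$ be the logical error. Finally let $$f(x)=\frac{\langle\mathcal K(x)\rangle-\mu^2}{1-\mu^2},\qquad \kappa(\Delta,m)=\Bigl(1+2\sum_{j=1}^{m-1}f(j\Delta)\Bigr)\Bigl(\frac1{\mu^2}-1\Bigr),$$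 where for $\mu^2=1$ one reads $f=0$, so that $\kappa=0$. **Theorem.** Suppose that $\langle\mathcal K(d)\rangle$ is convex in the distance $d$, i.e. $2\langle\mathcal K(d+2)\rangle\le\langle\mathcal K(d)\rangle+\langle\mathcal K(d+4)\rangle$ for all even $d\ge0$ with $d+4\le n$. Then, for all even $\Delta>0$ and all $m$ with $m\Delta=n$: 1. $M$ is the logical operation that the measurement-based computation implements. That is, let the sites $1,\dots,p$, with $1\le p$ and $p+2\xi<a$, be measured adaptively at arbitrary angles (site $i$ in the eigenbasis of $\cos\gamma_iX_i-(-1)^{q_i}\sin\gamma_iY_i$, where $q_i=s_{i-1}+s_{i-3}+\cdots$ and $s_j$ are the outcomes), and all other sites before $N$ at angle $0$. Changing the angle on the sites $a+k\Delta$, $0\le k<m$, from $0$ to any $\gamma$ then multiplies the logical Bloch vector $(\langle\mathcal X\rangle,\langle\mathcal Y\rangle,\langle\mathcal Z\rangle)$ read out at site $N$ by $M$ (taken at the angle $\gamma$). Here the components are the expectation values of $(-1)^o$, with $o$ the sum of the outcome of the measurement of $X$, $Y$, $Z$ at site $N$ and of the outcomes on the odd, all, even sites before $N$, respectively. 2.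 $\bigl|\mathcal D_m(\Delta)-\beta^2\kappa(\Delta,m)/m\bigr|\le C/m^2$, with a constant $C$ that depends only on $\xi$, $\beta$ and $\mu$. 3. For the fixed number $n$ of qubits, the leading-order logical error is minimized by the densest packing $\Delta=2$: $$\beta^2\,\frac{\kappa(2,n/2)}{n/2}\;\le\;\beta^2\,\frac{\kappa(\Delta,m)}{m}.$$ -/

import Mathlib

open Matrix Finset

namespace ClusterMBQC

noncomputable section

/-! ### Qubit chains

Sites carry the labels `1, …, N`; the element `i : Fin N` is the site with label `i + 1`. -/

/-- Computational-basis configurations of `N` qubits. -/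
abbrev Conf (N : ℕ) : Type := Fin N → Fin 2

/-- Linear operators on `(ℂ²)^{⊗N}`. -/
abbrev Op (N : ℕ) : Type := Matrix (Conf N) (Conf N) ℂ

/-- The label of a site. -/
def lab {N : ℕ} (i : Fin N) : ℕ := (i : ℕ) + 1

def pauliX : Matrix (Fin 2) (Fin 2) ℂ := !![0, 1; 1, 0]

def pauliZ : Matrix (Fin 2) (Fin 2) ℂ := !![1, 0; 0, -1]

/-- The tensor product `⊗ᵢ P i` over all sites, `P` being indexed by labels. -/
def tensorOp (N : ℕ) (P : ℕ → Matrix (Fin 2) (Fin 2) ℂ) : Op N :=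
  Matrix.of fun s t => ∏ i : Fin N, P (lab i) (s i) (t i)

/-- The expectation value `⟨Φ|A|Φ⟩`; the real part only discards the vanishing imaginary part,
since it is used for Hermitian `A`. -/
def expval {N : ℕ} (Φ : Conf N → ℂ) (A : Op N) : ℝ := (star Φ ⬝ᵥ (A *ᵥ Φ)).re

/-- The product state `|+⟩|+⟩…|+⟩`. -/
def plusState (N : ℕ) : Conf N → ℂ := fun _ => ((1 / Real.sqrt 2 : ℝ) : ℂ) ^ N

/-- The support of `A` is contained in `S`: `A = B ⊗ 1` with `B` acting on the sites in `S`. -/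
def SupportedOn {N : ℕ} (S : Set (Fin N)) (A : Op N) : Prop :=
  ∃ B : Matrix (S → Fin 2) (S → Fin 2) ℂ, ∀ s t : Conf N,
    ((∀ i, i ∉ S → s i = t i) → A s t = B (fun i => s i) (fun i => t i)) ∧
    ((∃ i, i ∉ S ∧ s i ≠ t i) → A s t = 0)

/-- `U` is a short-range entangled circuit with entanglement range `ξ`: conjugation by `U` moves
the end of the support of an operator by at most `ξ` sites. -/
structure IsShortRange {N : ℕ} (ξ : ℕ) (U : Op N) : Prop where
  unitary : U ∈ Matrix.unitaryGroup (Conf N) ℂ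
  left : ∀ (k : ℕ) (A : Op N), SupportedOn {i | lab i ≤ k} A →
    SupportedOn {i | lab i ≤ k + ξ} (Uᴴ * A * U)
  right : ∀ (k : ℕ) (A : Op N), SupportedOn {i | k < lab i} A →
    SupportedOn {i | k < lab i + ξ} (Uᴴ * A * U)

/-! ### Symmetry and string order -/

/-- `g₀ = Z₁ X₂ X₄ … X_{N-1} Z_N` (`N` odd). -/
def symG0 (N : ℕ) : Op N :=
  tensorOp N fun i => if i = 1 ∨ i = N then pauliZ else if Even i then pauliX else 1

/-- `g₁ = X₁ X₃ … X_N` (`N` odd). -/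
def symG1 (N : ℕ) : Op N := tensorOp N fun i => if Odd i then pauliX else 1

/-- `K_{≥k}`: this is `Z_k X_{k+1} X_{k+3} … X_{N-1} Z_N` for `k` odd and
`Z_k X_{k+1} X_{k+3} … X_N` for `k` even (`N` odd, `1 ≤ k < N`). -/
def stringGE (N k : ℕ) : Op N :=
  tensorOp N fun i =>
    if i = k then pauliZ
    else if k < i ∧ Odd (i - k) then pauliX
    else if i = N then pauliZ else 1

/-- `K_{k,l} = Z_k X_{k+1} X_{k+3} … X_{l-1} Z_l` for `k ≤ l`, `l - k` even; it is the identity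
`Z_k Z_k` for `k = l`. -/
def stringBetween (N k l : ℕ) : Op N :=
  tensorOp N fun i =>
    (if i = k then pauliZ else 1) * (if k < i ∧ i < l ∧ Odd (i - k) then pauliX else 1) *
      (if i = l then pauliZ else 1)

/-- A short-range entangled (range `ξ`), `ℤ₂ × ℤ₂`-symmetric state of `N` qubits. -/
structure IsSymmetricSRE {N : ℕ} (ξ : ℕ) (Φ : Conf N → ℂ) : Prop where
  circuit : ∃ U : Op N, IsShortRange ξ U ∧ Φ = U *ᵥ plusState N
  sym0 : symG0 N *ᵥ Φ = Φ
  sym1 : symG1 N *ᵥ Φ = Φ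

/-- Translation invariance (by even distances) of the string order on the sites `a, …, a + n` of
the sublattice of `a`: `⟨K_{≥k}⟩ = μ` is constant there, and `⟨K_{k,l}⟩ = K (l - k)` depends on the
distance only. -/
structure HasStringOrder {N : ℕ} (Φ : Conf N → ℂ) (a n : ℕ) (μ : ℝ) (K : ℕ → ℝ) : Prop where
  single : ∀ x, Even x → x ≤ n → expval Φ (stringGE N (a + x)) = μ
  pair : ∀ x y, Even x → Even y → x ≤ y → y ≤ n →
    expval Φ (stringBetween N (a + x) (a + y)) = K (y - x)

/-- `K` is convex as a function on the even distances `0, 2, …, n`. -/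
def ConvexUpTo (n : ℕ) (K : ℕ → ℝ) : Prop :=
  ∀ d, Even d → d + 4 ≤ n → 2 * K (d + 2) ≤ K d + K (d + 4)

/-! ### Measurement-based computation by the Born rule -/

/-- Normalised eigenvector, with eigenvalue `(-1)^s`, of `cos γ X - (-1)^q sin γ Y`. -/
def measVec (γ : ℝ) (q s : ℕ) : Fin 2 → ℂ :=
  ![((1 / Real.sqrt 2 : ℝ) : ℂ),
    ((1 / Real.sqrt 2 : ℝ) : ℂ) * (-1) ^ s *
      Complex.exp (-(((-1) ^ q * γ : ℝ) : ℂ) * Complex.I)]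

/-- Normalised eigenvector, with eigenvalue `(-1)^s`, of the observable `X` (`P = 0`),
`Y` (`P = 1`) or `Z` (`P = 2`). -/
def readoutVec (P : Fin 3) (s : Fin 2) : Fin 2 → ℂ :=
  match P with
  | 0 => ![((1 / Real.sqrt 2 : ℝ) : ℂ), ((1 / Real.sqrt 2 : ℝ) : ℂ) * (-1) ^ (s : ℕ)]
  | 1 => ![((1 / Real.sqrt 2 : ℝ) : ℂ), ((1 / Real.sqrt 2 : ℝ) : ℂ) * (-1) ^ (s : ℕ) * Complex.I]
  | 2 => Pi.single s 1

/-- The adaptation `q_i = s_{i-1} + s_{i-3} + …` computed from the earlier outcomes. -/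
def flips {N : ℕ} (s : Conf N) (i : Fin N) : ℕ :=
  ∑ j : Fin N, if j < i ∧ Odd (lab i - lab j) then (s j : ℕ) else 0

/-- The product vector `|s⟩` for the outcome record `s`: the sites `i < N` are measured adaptively
with angles `γ`, the last site is measured in the readout basis `P`. -/
def recordVec {N : ℕ} (γ : ℕ → ℝ) (P : Fin 3) (s : Conf N) : Conf N → ℂ := fun t =>
  ∏ i : Fin N, if lab i = N then readoutVec P (s i) (t i)
    else measVec (γ (lab i)) (flips s i) (s i : ℕ) (t i)

/-- The probability `|⟨s|Φ⟩|²` of the outcome record `s`. -/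
def recordProb {N : ℕ} (Φ : Conf N → ℂ) (γ : ℕ → ℝ) (P : Fin 3) (s : Conf N) : ℝ :=
  ‖star (recordVec γ P s) ⬝ᵥ Φ‖ ^ 2

/-- The sites that contribute to the computational output for readout `P` : the last site and the
odd sites (`X`), all sites (`Y`), the even sites (`Z`). -/
def contributes (N : ℕ) (P : Fin 3) (i : ℕ) : Prop :=
  i = N ∨ P = 1 ∨ (P = 0 ∧ Odd i) ∨ (P = 2 ∧ Even i)

open Classical in
/-- The computational output bit, as a number whose parity counts. -/
def outputBit {N : ℕ} (P : Fin 3) (s : Conf N) : ℕ :=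
  ∑ i : Fin N, if contributes N P (lab i) then (s i : ℕ) else 0

/-- The logical Bloch vector `(⟨X⟩, ⟨Y⟩, ⟨Z⟩)` produced by the measurement angles `γ`. -/
def bloch {N : ℕ} (Φ : Conf N → ℂ) (γ : ℕ → ℝ) : Fin 3 → ℝ := fun P =>
  ∑ s : Conf N, (-1) ^ outputBit P s * recordProb Φ γ P s

open Classical in
/-- Measurement angles: the preparation angles `θ`, changed to `γ` on the `m` symmetry-breaking
sites `a, a + Δ, …, a + (m - 1) Δ`. -/
def withRotation (θ : ℕ → ℝ) (a Δ m : ℕ) (γ : ℝ) : ℕ → ℝ := fun i =>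
  if ∃ j, j < m ∧ i = a + j * Δ then γ else θ i

/-! ### The implemented logical operation and its error -/

/-- The rotation-type `3 × 3` matrix with "cosine" `c` and "sine" `S`: about the `z`-axis if the
sites used have odd labels, about the `x`-axis if they have even labels. -/
def rotMatrix {A : Type*} [Ring A] (a : ℕ) (c S : A) : Matrix (Fin 3) (Fin 3) A :=
  if Odd a then !![c, -S, 0; S, c, 0; 0, 0, 1] else !![1, 0, 0; 0, c, -S; 0, S, c]

/-- The product, over the sites `a + k Δ` with `k < m`, of the matrices `M_k` with entries
`cos γ`, `± sin γ K_{≥ a + k Δ}` in the ring of operators. -/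
def stepProduct (N a Δ : ℕ) (γ : ℝ) : ℕ → Matrix (Fin 3) (Fin 3) (Op N)
  | 0 => 1
  | k + 1 => rotMatrix a ((Real.cos γ : ℂ) • (1 : Op N))
      ((Real.sin γ : ℂ) • stringGE N (a + k * Δ)) * stepProduct N a Δ γ k

/-- The implemented logical operation on Bloch vectors, `⟨∏ₖ M_k⟩`. -/
def logicalOp {N : ℕ} (Φ : Conf N → ℂ) (a Δ m : ℕ) (γ : ℝ) : Matrix (Fin 3) (Fin 3) ℝ :=
  Matrix.of fun i j => expval Φ (stepProduct N a Δ γ m i j)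

/-- The `4 × 4` matrix, in the basis `1, X, Y, Z`, of the trace-preserving unital qubit operation
which acts as `M` on Bloch vectors. -/
def transferMatrix (M : Matrix (Fin 3) (Fin 3) ℝ) : Matrix (Fin 1 ⊕ Fin 3) (Fin 1 ⊕ Fin 3) ℝ :=
  Matrix.fromBlocks 1 0 0 M

/-- The distance `√(2 Tr((M - R)† (M - R)))` of two qubit operations. -/
def opDist (M R : Matrix (Fin 3) (Fin 3) ℝ) : ℝ :=
  Real.sqrt (2 * ((transferMatrix M - transferMatrix R)ᴴ *
    (transferMatrix M - transferMatrix R)).trace)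

/-- The measurement angle used to split a rotation by `β` into `m` parts, when `⟨K_≥⟩ = μ`. -/
def splitAngle (β μ : ℝ) (m : ℕ) : ℝ := β / (m * μ)

/-- The logical error of the rotation by `β` split into `m` parts at spacing `Δ`. -/
def logicalError {N : ℕ} (Φ : Conf N → ℂ) (a : ℕ) (β μ : ℝ) (Δ m : ℕ) : ℝ :=
  opDist (logicalOp Φ a Δ m (splitAngle β μ m)) (rotMatrix a (Real.cos β) (Real.sin β))

/-- `f(x) = (⟨K(x)⟩ - ⟨K_≥⟩²) / (1 - ⟨K_≥⟩²)`. -/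
def corrF (μ : ℝ) (K : ℕ → ℝ) (x : ℕ) : ℝ := (K x - μ ^ 2) / (1 - μ ^ 2)

/-- The efficiency characteristic `κ`. -/
def kappa (μ : ℝ) (K : ℕ → ℝ) (Δ m : ℕ) : ℝ :=
  (1 + 2 * ∑ j ∈ Finset.Icc 1 (m - 1), corrF μ K (j * Δ)) * (1 / μ ^ 2 - 1)

/-- The leading-order (order `1/m`) logical error `β² κ / m`. -/
def leadingError (β μ : ℝ) (K : ℕ → ℝ) (Δ m : ℕ) : ℝ := β ^ 2 * kappa μ K Δ m / m

end

end ClusterMBQC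

open ClusterMBQC

/-!
The three claims rest on two descriptions of the same chain.

*Statistics of the string operators.* The strings `K_{≥b}` with `b` on the sublattice of `a` are
products of `Z` on that sublattice and `X` on the other one, so a product basis
(`sublatticeBasis`) diagonalises them all: measured in `Φ` they become `±1`-valued functions of
the bits of a classical random configuration (`basisWeight`). Multiplying `K_{≥b}` by the
symmetry `g₀` or `g₁`, which has the value `1` almost surely, turns it into a function of the bits
up to `b`. Operators whose light cones do not overlap are uncorrelated in a short-range entangled
state (`IsShortRange.cexpval_mul`), hence strings to the left of a gap of more than `2ξ` sites are
independent of those to the right of it (`stringGE_independent`).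

*The error.* Since the strings commute, `∏ₖ M_k` is the rotation by `γ ∑ σ_k` in every basis vector,
and the error is `2 |E exp(iγ ∑ (σ_k - μ)) - 1|`. To leading order this is `γ²` times the variance
of `∑ σ_k`. For variables with a finite dependence range, the third moment of the centred sum of
`m` terms is `O(m)` and the fourth is `O(m²)` (`IsWeaklyDependent.abs_wmean_cube_le`,
`IsWeaklyDependent.wmean_pow_four_le`), and the variance differs by `O(1)` from `m` times the
truncated sum of correlations in `κ` (`IsWeaklyDependent.abs_variance_sub_le`). With `γ = β / (mμ)`
all corrections are `O(1/m²)`. The leading term `κ / m` is a trapezoidal sum of the convex function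
`f`, which is `1` at distance `0` and `0` at distance `n > 2ξ`; refining the grid of the
trapezoidal rule lowers it (`trapezoid_le_of_convex`).

*The implemented operation.* The unitary `exp(i (γ/2) Z_b X_{b-1} X_{b-3} …)` turns the measurement
basis at angle `0` on the site `b` into the adaptive one at angle `γ` (`recordVec_eq_smul`), so the
measured observable is the logical Pauli operator conjugated by these unitaries
(`recordObs_eq_conj_logicalPauli`). As `Z_b X_{b-1} X_{b-3} …` is `K_{≥b}` times a logical Pauli
operator, conjugation with the unitary of the site `b` applies the matrix `M_k`
(`siteRotation_conj_logicalPauli`). Up to a symmetry of `Φ`, the observables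
measured with the preparation angles act on the sites `1, …, p`, and decoupling makes the
expectation value of their product with the entries of `∏ₖ M_k` factorise.
-/

namespace ClusterMBQC

/-! ### Site-wise tensor products -/

/-- The tensor product `⊗ᵢ P i`, indexed by sites rather than by labels. -/
def siteTensor {N : ℕ} (P : Fin N → Matrix (Fin 2) (Fin 2) ℂ) : Op N :=
  Matrix.of fun s t => ∏ i, P i (s i) (t i)

lemma siteTensor_apply {N : ℕ} (P : Fin N → Matrix (Fin 2) (Fin 2) ℂ) (s t : Conf N) :
    siteTensor P s t = ∏ i, P i (s i) (t i) := rfl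

lemma tensorOp_eq_siteTensor (N : ℕ) (P : ℕ → Matrix (Fin 2) (Fin 2) ℂ) :
    tensorOp N P = siteTensor fun i : Fin N => P (lab i) := rfl

lemma siteTensor_mul {N : ℕ} (P Q : Fin N → Matrix (Fin 2) (Fin 2) ℂ) :
    siteTensor P * siteTensor Q = siteTensor fun i => P i * Q i := by
  ext s t
  simp only [Matrix.mul_apply, siteTensor_apply]
  rw [Finset.prod_univ_sum, Fintype.piFinset_univ]
  exact Finset.sum_congr rfl fun u _ => Finset.prod_mul_distrib.symm

lemma siteTensor_one {N : ℕ} : siteTensor (fun _ : Fin N => 1) = 1 := by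
  ext s t
  rw [siteTensor_apply]
  by_cases h : s = t
  · subst h; simp
  · obtain ⟨i, hi⟩ := Function.ne_iff.mp h
    rw [Matrix.one_apply_ne h]
    exact Finset.prod_eq_zero (Finset.mem_univ i) (Matrix.one_apply_ne hi)

lemma siteTensor_diagonal {N : ℕ} (d : Fin N → Fin 2 → ℂ) :
    siteTensor (fun i => diagonal (d i)) = diagonal fun s => ∏ i, d i (s i) := by
  ext s t
  rw [siteTensor_apply]
  by_cases h : s = t
  · subst h; simp
  · obtain ⟨i, hi⟩ := Function.ne_iff.mp h
    rw [Matrix.diagonal_apply_ne _ h]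
    exact Finset.prod_eq_zero (Finset.mem_univ i) (Matrix.diagonal_apply_ne _ hi)

lemma siteTensor_conjTranspose {N : ℕ} (P : Fin N → Matrix (Fin 2) (Fin 2) ℂ) :
    (siteTensor P)ᴴ = siteTensor fun i => (P i)ᴴ := by
  ext s t
  simp [siteTensor_apply, Matrix.conjTranspose_apply]

lemma siteTensor_mulVec {N : ℕ} (P : Fin N → Matrix (Fin 2) (Fin 2) ℂ) (v : Fin N → Fin 2 → ℂ) :
    siteTensor P *ᵥ (fun t => ∏ i, v i (t i)) = fun t => ∏ i, (P i *ᵥ v i) (t i) := by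
  ext s
  simp only [Matrix.mulVec, dotProduct, siteTensor_apply]
  rw [Finset.prod_univ_sum, Fintype.piFinset_univ]
  exact Finset.sum_congr rfl fun u _ => Finset.prod_mul_distrib.symm

/-- A scalar on one site can be pulled out of a tensor product. -/
lemma siteTensor_smul_site {N : ℕ} (P Q : Fin N → Matrix (Fin 2) (Fin 2) ℂ) (c : ℂ) (j : Fin N)
    (hj : P j = c • Q j) (h : ∀ i, i ≠ j → P i = Q i) :
    siteTensor P = c • siteTensor Q := by
  ext s t
  rw [Matrix.smul_apply, siteTensor_apply, siteTensor_apply,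
    ← Finset.mul_prod_erase _ _ (Finset.mem_univ j),
    ← Finset.mul_prod_erase _ (fun i => Q i (s i) (t i)) (Finset.mem_univ j), hj,
    Finset.prod_congr rfl fun i hi => by rw [h i (Finset.ne_of_mem_erase hi)]]
  simp [mul_assoc]

/-! ### Supports -/

open scoped Kronecker

open Classical in
/-- Splitting a configuration into its parts inside and outside `S`. -/
noncomputable def splitConf {N : ℕ} (S : Set (Fin N)) :
    Conf N ≃ (S → Fin 2) × ({i // i ∉ S} → Fin 2) :=
  Equiv.piEquivPiSubtypeProd (· ∈ S) fun _ => Fin 2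

open Classical in
lemma supportedOn_iff_kronecker {N : ℕ} (S : Set (Fin N)) (A : Op N) :
    SupportedOn S A ↔ ∃ B : Matrix (S → Fin 2) (S → Fin 2) ℂ,
      A = (B ⊗ₖ (1 : Matrix ({i // i ∉ S} → Fin 2) ({i // i ∉ S} → Fin 2) ℂ)).submatrix
        (splitConf S) (splitConf S) := by
  refine exists_congr fun B => ⟨fun h => ?_, ?_⟩
  · ext s t
    simp only [submatrix_apply, kronecker_apply, splitConf, Equiv.piEquivPiSubtypeProd_apply]
    by_cases hst : ∀ i, i ∉ S → s i = t i
    · rw [(h s t).1 hst]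
      have : (fun x : {i // i ∉ S} => s x) = fun x : {i // i ∉ S} => t x :=
        funext fun x => hst x x.2
      rw [this, Matrix.one_apply_eq, mul_one]
    · push Not at hst
      rw [(h s t).2 hst]
      have : (fun x : {i // i ∉ S} => s x) ≠ fun x : {i // i ∉ S} => t x := by
        obtain ⟨i, hi, hne⟩ := hst
        exact fun he => hne (congrFun he ⟨i, hi⟩)
      rw [Matrix.one_apply_ne this, mul_zero]
  · rintro rfl s t
    simp only [submatrix_apply, kronecker_apply, splitConf, Equiv.piEquivPiSubtypeProd_apply]
    refine ⟨fun hst => ?_, fun ⟨i, hi, hne⟩ => ?_⟩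
    · have : (fun x : {i // i ∉ S} => s x) = fun x : {i // i ∉ S} => t x :=
        funext fun x => hst x x.2
      rw [this, Matrix.one_apply_eq, mul_one]
    · have : (fun x : {i // i ∉ S} => s x) ≠ fun x : {i // i ∉ S} => t x :=
        fun he => hne (congrFun he ⟨i, hi⟩)
      rw [Matrix.one_apply_ne this, mul_zero]

open Classical in
/-- An operator whose support avoids `S` acts trivially on the tensor factor of `S`. -/
lemma SupportedOn.exists_one_kronecker {N : ℕ} {S T : Set (Fin N)} {A : Op N}
    (hA : SupportedOn T A) (hST : Disjoint S T) :
    ∃ D : Matrix ({i // i ∉ S} → Fin 2) ({i // i ∉ S} → Fin 2) ℂ,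
      A = ((1 : Matrix (S → Fin 2) (S → Fin 2) ℂ) ⊗ₖ D).submatrix (splitConf S) (splitConf S) := by
  obtain ⟨B, hB⟩ := hA
  refine ⟨fun x y => A ((splitConf S).symm (0, x)) ((splitConf S).symm (0, y)), ?_⟩
  have hin : ∀ (z : (S → Fin 2) × ({i // i ∉ S} → Fin 2)) (i : Fin N) (hi : i ∉ S),
      (splitConf S).symm z i = z.2 ⟨i, hi⟩ := fun z i hi => by
    simp [splitConf, Equiv.piEquivPiSubtypeProd, hi]
  have hon : ∀ (z : (S → Fin 2) × ({i // i ∉ S} → Fin 2)) (i : Fin N) (hi : i ∈ S),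
      (splitConf S).symm z i = z.1 ⟨i, hi⟩ := fun z i hi => by
    simp [splitConf, Equiv.piEquivPiSubtypeProd, hi]
  have hTS : ∀ i ∈ T, i ∉ S := fun i hi hS => Set.disjoint_left.mp hST hS hi
  ext s t
  change A s t = (1 : Matrix (S → Fin 2) (S → Fin 2) ℂ) (splitConf S s).1 (splitConf S t).1 *
    A ((splitConf S).symm (0, (splitConf S s).2)) ((splitConf S).symm (0, (splitConf S t).2))
  by_cases hst : (splitConf S s).1 = (splitConf S t).1
  · rw [hst, Matrix.one_apply_eq, one_mul]
    by_cases hT : ∀ i, i ∉ T → s i = t i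
    · rw [(hB s t).1 hT, (hB _ _).1]
      · congr 1
        · funext i; rw [hin _ _ (hTS i i.2)]; rfl
        · funext i; rw [hin _ _ (hTS i i.2)]; rfl
      · intro i hi
        by_cases hS : i ∈ S
        · rw [hon _ _ hS, hon _ _ hS]
        · rw [hin _ _ hS, hin _ _ hS]; exact hT i hi
    · push Not at hT
      obtain ⟨i, hi, hne⟩ := hT
      rw [(hB s t).2 ⟨i, hi, hne⟩, (hB _ _).2]
      have hS : i ∉ S := fun hS => hne (congrFun hst ⟨i, hS⟩)
      refine ⟨i, hi, ?_⟩
      rw [hin _ _ hS, hin _ _ hS]; exact hne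
  · rw [Matrix.one_apply_ne hst, zero_mul]
    obtain ⟨i, hi⟩ := Function.ne_iff.mp hst
    exact (hB s t).2 ⟨i, fun hT => hTS i hT i.2, hi⟩

lemma SupportedOn.mul {N : ℕ} {S : Set (Fin N)} {A B : Op N}
    (hA : SupportedOn S A) (hB : SupportedOn S B) : SupportedOn S (A * B) := by
  classical
  rw [supportedOn_iff_kronecker] at *
  obtain ⟨A', rfl⟩ := hA
  obtain ⟨B', rfl⟩ := hB
  refine ⟨A' * B', ?_⟩
  rw [submatrix_mul_equiv, ← mul_kronecker_mul, one_mul]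

lemma SupportedOn.add {N : ℕ} {S : Set (Fin N)} {A B : Op N}
    (hA : SupportedOn S A) (hB : SupportedOn S B) : SupportedOn S (A + B) := by
  classical
  rw [supportedOn_iff_kronecker] at *
  obtain ⟨A', rfl⟩ := hA
  obtain ⟨B', rfl⟩ := hB
  exact ⟨A' + B', by rw [add_kronecker]; rfl⟩

lemma SupportedOn.smul {N : ℕ} {S : Set (Fin N)} {A : Op N} (c : ℂ)
    (hA : SupportedOn S A) : SupportedOn S (c • A) := by
  classical
  rw [supportedOn_iff_kronecker] at *
  obtain ⟨A', rfl⟩ := hA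
  exact ⟨c • A', by rw [smul_kronecker]; rfl⟩

lemma SupportedOn.conjTranspose {N : ℕ} {S : Set (Fin N)} {A : Op N}
    (hA : SupportedOn S A) : SupportedOn S Aᴴ := by
  classical
  rw [supportedOn_iff_kronecker] at *
  obtain ⟨A', rfl⟩ := hA
  exact ⟨A'ᴴ, by rw [conjTranspose_submatrix, conjTranspose_kronecker, conjTranspose_one]⟩

lemma supportedOn_zero {N : ℕ} (S : Set (Fin N)) : SupportedOn S (0 : Op N) :=
  ⟨0, fun _ _ => ⟨fun _ => rfl, fun _ => rfl⟩⟩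

lemma supportedOn_sum {N : ℕ} {S : Set (Fin N)} {ι : Type*} (I : Finset ι) (A : ι → Op N)
    (hA : ∀ i ∈ I, SupportedOn S (A i)) : SupportedOn S (∑ i ∈ I, A i) := by
  classical
  induction I using Finset.induction_on with
  | empty => simpa using supportedOn_zero S
  | insert j I hj ih =>
    rw [Finset.sum_insert hj]
    exact (hA j (Finset.mem_insert_self j I)).add
      (ih fun i hi => hA i (Finset.mem_insert_of_mem hi))

lemma supportedOn_siteTensor {N : ℕ} {S : Set (Fin N)} {P : Fin N → Matrix (Fin 2) (Fin 2) ℂ}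
    (hP : ∀ i, i ∉ S → P i = 1) : SupportedOn S (siteTensor P) := by
  classical
  refine ⟨fun x y => ∏ i : S, P i (x i) (y i), fun s t => ⟨fun hst => ?_, ?_⟩⟩
  · rw [siteTensor_apply, ← Fintype.prod_subtype_mul_prod_subtype (· ∈ S)]
    rw [Finset.prod_eq_one (s := (Finset.univ : Finset {i // i ∉ S})), mul_one]
    rintro ⟨i, hi⟩ -
    simp [hP i hi, hst i hi]
  · rintro ⟨i, hi, hne⟩
    rw [siteTensor_apply]
    refine Finset.prod_eq_zero (Finset.mem_univ i) ?_
    rw [hP i hi, Matrix.one_apply_ne hne]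

lemma supportedOn_one {N : ℕ} (S : Set (Fin N)) : SupportedOn S (1 : Op N) := by
  rw [← siteTensor_one]
  exact supportedOn_siteTensor fun _ _ => rfl

/-! ### Decoupling in short-range entangled states -/

/-- The complex expectation value `⟨Φ|A|Φ⟩`. -/
noncomputable def cexpval {N : ℕ} (Φ : Conf N → ℂ) (A : Op N) : ℂ := star Φ ⬝ᵥ (A *ᵥ Φ)

lemma expval_eq_re {N : ℕ} (Φ : Conf N → ℂ) (A : Op N) : expval Φ A = (cexpval Φ A).re := rfl

lemma cexpval_sum {N : ℕ} (Φ : Conf N → ℂ) {ι : Type*} (I : Finset ι) (A : ι → Op N) :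
    cexpval Φ (∑ i ∈ I, A i) = ∑ i ∈ I, cexpval Φ (A i) := by
  simp [cexpval, sum_mulVec, dotProduct_sum]

lemma cexpval_smul {N : ℕ} (Φ : Conf N → ℂ) (c : ℂ) (A : Op N) :
    cexpval Φ (c • A) = c * cexpval Φ A := by
  simp [cexpval, smul_mulVec]

/-- Heisenberg picture. -/
lemma cexpval_mulVec {N : ℕ} (Φ : Conf N → ℂ) (U A : Op N) :
    cexpval (U *ᵥ Φ) A = cexpval Φ (Uᴴ * A * U) := by
  simp only [cexpval, star_mulVec, ← Matrix.mulVec_mulVec, Matrix.dotProduct_mulVec,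
    Matrix.vecMul_vecMul]

lemma star_cexpval {N : ℕ} (Φ : Conf N → ℂ) (A : Op N) :
    star (cexpval Φ A) = cexpval Φ Aᴴ := by
  simp only [cexpval]
  rw [star_dotProduct, star_star, star_mulVec, ← Matrix.dotProduct_mulVec]

lemma cexpval_plusState {N : ℕ} (A : Op N) :
    cexpval (plusState N) A = ((1 / 2 : ℂ)) ^ N * ∑ s, ∑ t, A s t := by
  have h2 : (starRingEnd ℂ) ((1 / Real.sqrt 2 : ℝ) : ℂ) * ((1 / Real.sqrt 2 : ℝ) : ℂ) = 1 / 2 := by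
    rw [Complex.conj_ofReal, ← Complex.ofReal_mul, div_mul_div_comm, Real.mul_self_sqrt (by simp)]
    simp
  simp only [cexpval, dotProduct, Matrix.mulVec, plusState, Pi.star_apply, star_pow,
    RCLike.star_def, ← h2, mul_pow, Finset.mul_sum]
  exact Finset.sum_congr rfl fun s _ => Finset.sum_congr rfl fun t _ => by ring

lemma cexpval_plusState_one (N : ℕ) : cexpval (plusState N) 1 = 1 := by
  rw [cexpval_plusState]
  simp [Matrix.one_apply]

open Classical in
/-- In `|+⟩…|+⟩`, operators with disjoint supports are uncorrelated. -/
lemma cexpval_plusState_mul {N : ℕ} {S T : Set (Fin N)} {A B : Op N} (hA : SupportedOn S A)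
    (hB : SupportedOn T B) (hST : Disjoint S T) :
    cexpval (plusState N) (A * B) = cexpval (plusState N) A * cexpval (plusState N) B := by
  have htot : ∀ (X : Matrix (S → Fin 2) (S → Fin 2) ℂ)
      (Y : Matrix ({i // i ∉ S} → Fin 2) ({i // i ∉ S} → Fin 2) ℂ),
      ∑ s, ∑ t, (X ⊗ₖ Y).submatrix (splitConf S) (splitConf S) s t
        = (∑ x, ∑ y, X x y) * ∑ x, ∑ y, Y x y := by
    intro X Y
    change ∑ s, ∑ t, X (splitConf S s).1 (splitConf S t).1 *
      Y (splitConf S s).2 (splitConf S t).2 = _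
    rw [Equiv.sum_comp (splitConf S) fun z => ∑ t,
      X z.1 (splitConf S t).1 * Y z.2 (splitConf S t).2]
    rw [Finset.sum_mul_sum, Fintype.sum_prod_type]
    refine Finset.sum_congr rfl fun x _ => Finset.sum_congr rfl fun x' _ => ?_
    rw [Equiv.sum_comp (splitConf S) fun z => X x z.1 * Y x' z.2, Finset.sum_mul_sum,
      Fintype.sum_prod_type]
  have hone := cexpval_plusState_one N
  obtain ⟨D, rfl⟩ := hB.exists_one_kronecker hST
  obtain ⟨C, rfl⟩ := (supportedOn_iff_kronecker S A).mp hA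
  have h1 : (1 : Op N) = ((1 : Matrix (S → Fin 2) (S → Fin 2) ℂ) ⊗ₖ
      (1 : Matrix ({i // i ∉ S} → Fin 2) ({i // i ∉ S} → Fin 2) ℂ)).submatrix
      (splitConf S) (splitConf S) := by
    rw [one_kronecker_one, submatrix_one_equiv]
  rw [h1, cexpval_plusState, htot] at hone
  rw [submatrix_mul_equiv, ← mul_kronecker_mul, one_mul, mul_one]
  simp only [cexpval_plusState, htot]
  linear_combination (-(1 / 2 : ℂ) ^ N * (∑ x, ∑ y, C x y) * ∑ x, ∑ y, D x y) * hone

lemma IsShortRange.cexpval_one {N ξ : ℕ} {U : Op N} (hU : IsShortRange ξ U) :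
    cexpval (U *ᵥ plusState N) 1 = 1 := by
  rw [cexpval_mulVec, mul_one, ← star_eq_conjTranspose, (Unitary.mem_iff.mp hU.unitary).1,
    cexpval_plusState_one]

/-- The decoupling property of short-range entangled states: operators to the left of `k` and to
the right of `l` are uncorrelated as soon as the light cones of `U` do not overlap. -/
lemma IsShortRange.cexpval_mul {N ξ k l : ℕ} {U : Op N} (hU : IsShortRange ξ U)
    {A B : Op N} (hA : SupportedOn {i | lab i ≤ k} A) (hB : SupportedOn {i | l < lab i} B)
    (hkl : k + 2 * ξ ≤ l) :
    cexpval (U *ᵥ plusState N) (A * B)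
      = cexpval (U *ᵥ plusState N) A * cexpval (U *ᵥ plusState N) B := by
  simp only [cexpval_mulVec]
  rw [← cexpval_plusState_mul (hU.left k A hA) (hU.right l B hB)]
  · congr 1
    have h : U * Uᴴ = 1 := (Unitary.mem_iff.mp hU.unitary).2
    calc Uᴴ * (A * B) * U = Uᴴ * A * 1 * B * U := by noncomm_ring
      _ = Uᴴ * A * (U * Uᴴ) * B * U := by rw [h]
      _ = _ := by noncomm_ring
  · rw [Set.disjoint_left]
    intro i hi hi'
    simp only [Set.mem_ofPred_eq] at hi hi'
    omega

/-! ### The local basis that diagonalises the string operators of one sublattice -/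

lemma pauliX_mul_self : pauliX * pauliX = 1 := by
  ext i j; fin_cases i <;> fin_cases j <;> simp [pauliX]

lemma pauliZ_mul_self : pauliZ * pauliZ = 1 := by
  ext i j; fin_cases i <;> fin_cases j <;> simp [pauliZ]

/-- The Hadamard matrix. -/
noncomputable def hadamard : Matrix (Fin 2) (Fin 2) ℂ :=
  ((1 / Real.sqrt 2 : ℝ) : ℂ) • !![1, 1; 1, -1]

lemma inv_sqrt_two_mul_self :
    ((1 / Real.sqrt 2 : ℝ) : ℂ) * ((1 / Real.sqrt 2 : ℝ) : ℂ) = 1 / 2 := by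
  rw [← Complex.ofReal_mul, div_mul_div_comm, Real.mul_self_sqrt (by simp)]
  simp

lemma hadamard_conjTranspose : hadamardᴴ = hadamard := by
  ext i j; fin_cases i <;> fin_cases j <;> simp [hadamard]

lemma hadamard_mul_self : hadamard * hadamard = 1 := by
  rw [hadamard, smul_mul_smul, inv_sqrt_two_mul_self]
  ext i j
  fin_cases i <;> fin_cases j <;> norm_num [Matrix.mul_apply, Fin.sum_univ_two]

/-- The eigenvalue `±1` belonging to a basis index of a qubit. -/
def bitSign (u : Fin 2) : ℝ := (-1) ^ (u : ℕ)

lemma bitSign_mul_self (u : Fin 2) : bitSign u * bitSign u = 1 := by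
  fin_cases u <;> simp [bitSign]

lemma pauliZ_eq_diagonal : pauliZ = diagonal fun u => (bitSign u : ℂ) := by
  ext i j; fin_cases i <;> fin_cases j <;> simp [pauliZ, bitSign]

lemma pauliX_mul_hadamard : pauliX * hadamard = hadamard * diagonal fun u => (bitSign u : ℂ) := by
  ext i j
  fin_cases i <;> fin_cases j <;>
    simp [pauliX, hadamard, bitSign, Matrix.mul_apply, Fin.sum_univ_two]

/-- The product basis which is the `Z`-basis on the sublattice of `a` and the `X`-basis on the
other sublattice. -/
noncomputable def sublatticeBasis (N a : ℕ) : Op N :=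
  siteTensor fun i => if Even (lab i + a) then 1 else hadamard

lemma sublatticeBasis_conjTranspose (N a : ℕ) : (sublatticeBasis N a)ᴴ = sublatticeBasis N a := by
  rw [sublatticeBasis, siteTensor_conjTranspose]
  congr 1; funext i
  split_ifs <;> simp [hadamard_conjTranspose]

lemma sublatticeBasis_mul_self (N a : ℕ) : sublatticeBasis N a * sublatticeBasis N a = 1 := by
  rw [sublatticeBasis, siteTensor_mul, ← siteTensor_one]
  congr 1; funext i
  split_ifs <;> simp [hadamard_mul_self]

/-- The operator that is diagonal in the basis `sublatticeBasis N a`, with eigenvalues `f`. -/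
noncomputable def diagOp {N : ℕ} (a : ℕ) (f : Conf N → ℝ) : Op N :=
  sublatticeBasis N a * diagonal (fun s => (f s : ℂ)) * sublatticeBasis N a

lemma diagOp_mul {N : ℕ} (a : ℕ) (f g : Conf N → ℝ) :
    diagOp a (fun s => f s * g s) = diagOp a f * diagOp a g := by
  have h := sublatticeBasis_mul_self N a
  simp only [diagOp]
  set V := sublatticeBasis N a
  set F := diagonal fun s => (f s : ℂ)
  set G := diagonal fun s => (g s : ℂ)
  have hFG : diagonal (fun s => ((f s * g s : ℝ) : ℂ)) = F * G := by
    simp [F, G, Matrix.diagonal_mul_diagonal]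
  rw [hFG]
  calc V * (F * G) * V = V * F * 1 * G * V := by noncomm_ring
    _ = V * F * (V * V) * G * V := by rw [h]
    _ = _ := by noncomm_ring

lemma diagOp_add {N : ℕ} (a : ℕ) (f g : Conf N → ℝ) :
    diagOp a (fun s => f s + g s) = diagOp a f + diagOp a g := by
  have : diagonal (fun s => ((f s + g s : ℝ) : ℂ))
      = diagonal (fun s => (f s : ℂ)) + diagonal fun s => (g s : ℂ) := by
    simp [Matrix.diagonal_add]
  rw [diagOp, this]
  simp only [diagOp, mul_add, add_mul]

lemma diagOp_neg {N : ℕ} (a : ℕ) (f : Conf N → ℝ) :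
    diagOp a (fun s => -f s) = -diagOp a f := by
  have : diagonal (fun s => ((-f s : ℝ) : ℂ)) = -diagonal (fun s => (f s : ℂ)) := by
    simp [Matrix.diagonal_neg]
  rw [diagOp, this]
  simp only [diagOp, mul_neg, neg_mul]

lemma diagOp_const {N : ℕ} (a : ℕ) (c : ℝ) : diagOp a (fun _ : Conf N => c) = (c : ℂ) • 1 := by
  have : diagonal (fun _ : Conf N => (c : ℂ)) = (c : ℂ) • 1 := by
    rw [← Matrix.diagonal_one, ← Matrix.diagonal_smul]; congr 1; funext s; simp
  rw [diagOp, this, mul_smul_comm, mul_one, smul_mul_assoc, sublatticeBasis_mul_self]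

lemma diagOp_conjTranspose {N : ℕ} (a : ℕ) (f : Conf N → ℝ) : (diagOp a f)ᴴ = diagOp a f := by
  rw [diagOp, conjTranspose_mul, conjTranspose_mul, sublatticeBasis_conjTranspose,
    diagonal_conjTranspose, ← mul_assoc]
  congr 3
  funext s
  simp

/-- A tensor product of operators that are diagonal in the local bases. -/
lemma tensorOp_eq_diagOp {N : ℕ} (a : ℕ) (P : ℕ → Matrix (Fin 2) (Fin 2) ℂ)
    (d : Fin N → Fin 2 → ℝ)
    (h : ∀ i : Fin N, P (lab i) * (if Even (lab i + a) then 1 else hadamard)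
      = (if Even (lab i + a) then 1 else hadamard) * diagonal fun u => (d i u : ℂ)) :
    tensorOp N P = diagOp a fun s => ∏ i, d i (s i) := by
  have h1 : tensorOp N P * sublatticeBasis N a
      = sublatticeBasis N a * diagonal fun s => ((∏ i, d i (s i) : ℝ) : ℂ) := by
    have : diagonal (fun s : Conf N => ((∏ i, d i (s i) : ℝ) : ℂ))
        = siteTensor fun i => diagonal fun u => (d i u : ℂ) := by
      rw [siteTensor_diagonal]; push_cast; rfl
    rw [this, tensorOp_eq_siteTensor, sublatticeBasis, siteTensor_mul, siteTensor_mul]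
    exact congrArg siteTensor (funext h)
  rw [diagOp, ← h1, mul_assoc, sublatticeBasis_mul_self, mul_one]

/-- The diagonal operator of a function of the bits in `S` acts on `S` only. -/
lemma supportedOn_diagOp {N : ℕ} (a : ℕ) {S : Set (Fin N)} {f : Conf N → ℝ}
    (hf : DependsOn f S) : SupportedOn S (diagOp a f) := by
  classical
  set Q : Conf N → Fin N → Matrix (Fin 2) (Fin 2) ℂ := fun c i =>
    if i ∈ S then diagonal (Pi.single (c i) 1) else diagonal (fun _ => 1 / 2)
  -- `f` is expanded into indicator functions of configurations on `S`; the factor `1 / 2` off `S`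
  -- compensates for the summation over the irrelevant bits
  have hexp : diagonal (fun s => (f s : ℂ)) = ∑ c, (f c : ℂ) • siteTensor (Q c) := by
    have hd : ∀ c, siteTensor (Q c) = diagonal fun s => ∏ i,
        if i ∈ S then (Pi.single (c i) 1 : Fin 2 → ℂ) (s i) else 1 / 2 := by
      intro c
      rw [← siteTensor_diagonal fun i u =>
        if i ∈ S then (Pi.single (c i) 1 : Fin 2 → ℂ) u else 1 / 2]
      congr 1; funext i
      by_cases hi : i ∈ S <;> simp [Q, hi]
    ext s t
    simp only [hd, Matrix.sum_apply, Matrix.smul_apply]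
    by_cases hst : s = t
    · subst hst
      simp only [diagonal_apply_eq, smul_eq_mul]
      have hterm : ∀ c : Conf N, (f c : ℂ) *
          (∏ i, if i ∈ S then (Pi.single (c i) 1 : Fin 2 → ℂ) (s i) else 1 / 2)
          = f s * ∏ i, if i ∈ S then (Pi.single (c i) 1 : Fin 2 → ℂ) (s i) else 1 / 2 := by
        intro c
        by_cases hc : ∀ i ∈ S, c i = s i
        · rw [hf hc]
        · push Not at hc
          obtain ⟨i, hi, hne⟩ := hc
          rw [Finset.prod_eq_zero (Finset.mem_univ i) (by simp [hi, hne.symm]), mul_zero, mul_zero]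
      rw [Finset.sum_congr rfl fun c _ => hterm c, ← Finset.mul_sum]
      have := Finset.prod_univ_sum (fun _ : Fin N => (Finset.univ : Finset (Fin 2)))
        fun i u => if i ∈ S then (Pi.single u 1 : Fin 2 → ℂ) (s i) else 1 / 2
      rw [Fintype.piFinset_univ] at this
      rw [← this, Finset.prod_eq_one, mul_one]
      intro i _
      by_cases hi : i ∈ S
      · simp [hi, Pi.single_apply]
      · simp [hi]
    · rw [diagonal_apply_ne _ hst]
      simp [diagonal_apply_ne _ hst]
  rw [diagOp, hexp, Finset.mul_sum, Finset.sum_mul]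
  refine supportedOn_sum _ _ fun c _ => ?_
  rw [mul_smul_comm, smul_mul_assoc]
  refine SupportedOn.smul _ ?_
  have hhalf : ∀ i ∉ S, (diagonal (fun _ : Fin 2 => (1 / 2 : ℂ))) = (1 / 2 : ℂ) • 1 := by
    intro i _; rw [← Matrix.diagonal_one, ← Matrix.diagonal_smul]; congr 1; funext s; simp
  set R : Fin N → Matrix (Fin 2) (Fin 2) ℂ := fun i =>
    (if Even (lab i + a) then 1 else hadamard) * Q c i *
      (if Even (lab i + a) then 1 else hadamard) with hR
  have : sublatticeBasis N a * siteTensor (Q c) * sublatticeBasis N a = siteTensor R := by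
    rw [sublatticeBasis, siteTensor_mul, siteTensor_mul]
  rw [this]
  have hR' : siteTensor R = (∏ i : Fin N, if i ∈ S then (1 : ℂ) else 1 / 2) •
      siteTensor fun i => if i ∈ S then R i else 1 := by
    ext s t
    rw [Matrix.smul_apply, siteTensor_apply, siteTensor_apply, smul_eq_mul,
      ← Finset.prod_mul_distrib]
    refine Finset.prod_congr rfl fun i _ => ?_
    by_cases hi : i ∈ S
    · simp [hi]
    · have : R i = (1 / 2 : ℂ) • 1 := by
        simp only [hR, Q, hi, if_false, hhalf i hi]
        split_ifs <;> simp [hadamard_mul_self]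
      simp [hi, this]
  rw [hR']
  exact SupportedOn.smul _ (supportedOn_siteTensor fun i hi => by simp [hi])

/-! ### The joint distribution of the string operators -/

/-- The probability to find `Φ` in a vector of the basis `sublatticeBasis N a`. -/
noncomputable def basisWeight {N : ℕ} (a : ℕ) (Φ : Conf N → ℂ) (s : Conf N) : ℝ :=
  ‖(sublatticeBasis N a *ᵥ Φ) s‖ ^ 2

lemma cexpval_diagOp {N : ℕ} (a : ℕ) (Φ : Conf N → ℂ) (f : Conf N → ℝ) :
    cexpval Φ (diagOp a f) = ((∑ s, basisWeight a Φ s * f s : ℝ) : ℂ) := by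
  have := cexpval_mulVec Φ (sublatticeBasis N a) (diagonal fun s => (f s : ℂ))
  rw [sublatticeBasis_conjTranspose] at this
  rw [diagOp, ← this, cexpval, dotProduct]
  push_cast
  refine Finset.sum_congr rfl fun s _ => ?_
  rw [mulVec_diagonal, basisWeight, Pi.star_apply, RCLike.star_def]
  push_cast
  rw [← Complex.conj_mul']
  ring

lemma expval_diagOp {N : ℕ} (a : ℕ) (Φ : Conf N → ℂ) (f : Conf N → ℝ) :
    expval Φ (diagOp a f) = ∑ s, basisWeight a Φ s * f s := by
  rw [expval_eq_re, cexpval_diagOp, Complex.ofReal_re]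

/-- Almost surely, a diagonal symmetry of `Φ` takes the value `1`. -/
lemma basisWeight_eq_zero_or {N : ℕ} {a : ℕ} {Φ : Conf N → ℂ} {f : Conf N → ℝ}
    (h : diagOp a f *ᵥ Φ = Φ) (s : Conf N) : basisWeight a Φ s = 0 ∨ f s = 1 := by
  have h1 : diagonal (fun s => (f s : ℂ)) *ᵥ (sublatticeBasis N a *ᵥ Φ)
      = sublatticeBasis N a *ᵥ Φ := by
    conv_rhs => rw [← h]
    rw [diagOp, Matrix.mulVec_mulVec, Matrix.mulVec_mulVec, ← mul_assoc, ← mul_assoc,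
      sublatticeBasis_mul_self, one_mul]
  have h2 := congrFun h1 s
  rw [mulVec_diagonal] at h2
  by_cases h0 : (sublatticeBasis N a *ᵥ Φ) s = 0
  · left; simp [basisWeight, h0]
  · right
    have := mul_right_cancel₀ h0 (h2.trans (one_mul _).symm)
    exact_mod_cast this

/-- The product of the signs of the bits on the sites with labels in `A`. -/
def signProd {N : ℕ} (A : ℕ → Prop) [DecidablePred A] (s : Conf N) : ℝ :=
  ∏ i : Fin N, if A (lab i) then bitSign (s i) else 1

lemma signProd_mul_self {N : ℕ} (A : ℕ → Prop) [DecidablePred A] (s : Conf N) :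
    signProd A s * signProd A s = 1 := by
  rw [signProd, ← Finset.prod_mul_distrib]
  refine Finset.prod_eq_one fun i _ => ?_
  split_ifs <;> simp [bitSign_mul_self]

lemma dependsOn_signProd {N : ℕ} (A : ℕ → Prop) [DecidablePred A] {S : Set (Fin N)}
    (hA : ∀ i : Fin N, A (lab i) → i ∈ S) : DependsOn (signProd A : Conf N → ℝ) S := by
  intro s t hst
  refine Finset.prod_congr rfl fun i _ => ?_
  split_ifs with h
  · rw [hst i (hA i h)]
  · rfl

lemma dependsOn_signProd_mul {N : ℕ} (A B : ℕ → Prop) [DecidablePred A] [DecidablePred B]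
    {S : Set (Fin N)} (hAB : ∀ i : Fin N, i ∉ S → (A (lab i) ↔ B (lab i))) :
    DependsOn (fun s : Conf N => signProd A s * signProd B s) S := by
  intro s t hst
  simp only [signProd, ← Finset.prod_mul_distrib]
  refine Finset.prod_congr rfl fun i _ => ?_
  by_cases hi : i ∈ S
  · rw [hst i hi]
  · have := hAB i hi
    by_cases hA : A (lab i)
    · simp [hA, this.mp hA, bitSign_mul_self]
    · have hB : ¬ B (lab i) := fun hB => hA (this.mpr hB)
      simp [hA, hB]

lemma tensorOp_eq_diagOp_signProd {N : ℕ} (a : ℕ) (A : ℕ → Prop) [DecidablePred A]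
    (P : ℕ → Matrix (Fin 2) (Fin 2) ℂ)
    (hP : ∀ i, 1 ≤ i → i ≤ N →
      P i = if A i then (if Even (i + a) then pauliZ else pauliX) else 1) :
    tensorOp N P = diagOp a (signProd A) := by
  rw [tensorOp_eq_diagOp a P fun i u => if A (lab i) then bitSign u else 1]
  · rfl
  · intro i
    rw [hP (lab i) (by simp [lab]) (by simp only [lab]; omega)]
    by_cases h1 : A (lab i) <;> by_cases h2 : Even (lab i + a) <;>
      simp [h1, h2, pauliZ_eq_diagonal, pauliX_mul_hadamard]

/-- The sites on which `K_{≥b}` acts. -/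
def stringSites (N b i : ℕ) : Prop := i = b ∨ (b < i ∧ Odd (i - b)) ∨ i = N

instance (N b : ℕ) : DecidablePred (stringSites N b) := fun i => by
  unfold stringSites; infer_instance

/-- The sites on which the symmetry `g₀` (odd `a`) or `g₁` (even `a`) acts. -/
def symSites (N a i : ℕ) : Prop := if Odd a then i = 1 ∨ i = N ∨ Even i else Odd i

instance (N a : ℕ) : DecidablePred (symSites N a) := fun i => by
  unfold symSites; infer_instance

lemma stringGE_eq_diagOp {N a b : ℕ} (hN : Odd N) (hb : b < N) (hab : Even (a + b)) :
    stringGE N b = diagOp a (signProd (stringSites N b)) := by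
  refine tensorOp_eq_diagOp_signProd a _ _ fun i h1 h2 => ?_
  simp only [stringSites, Nat.even_iff, Nat.odd_iff] at *
  split_ifs <;> first | rfl | (exfalso; omega)

lemma symG0_eq_diagOp {N a : ℕ} (hN : Odd N) (ha : Odd a) :
    symG0 N = diagOp a (signProd (symSites N a)) := by
  refine tensorOp_eq_diagOp_signProd a _ _ fun i h1 h2 => ?_
  simp only [symSites, ha, if_true]
  simp only [Nat.even_iff, Nat.odd_iff] at *
  split_ifs <;> first | rfl | (exfalso; omega)

lemma symG1_eq_diagOp {N a : ℕ} (ha : ¬ Odd a) :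
    symG1 N = diagOp a (signProd (symSites N a)) := by
  refine tensorOp_eq_diagOp_signProd a _ _ fun i h1 h2 => ?_
  simp only [symSites, ha, if_false]
  simp only [Nat.even_iff, Nat.odd_iff] at *
  split_ifs <;> first | rfl | (exfalso; omega)

lemma diagOp_symSites_mulVec {N ξ : ℕ} {Φ : Conf N → ℂ} (hN : Odd N) (a : ℕ)
    (hΦ : IsSymmetricSRE ξ Φ) : diagOp a (signProd (symSites N a)) *ᵥ Φ = Φ := by
  by_cases ha : Odd a
  · rw [← symG0_eq_diagOp hN ha, hΦ.sym0]
  · rw [← symG1_eq_diagOp ha, hΦ.sym1]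

lemma stringGE_mul_stringGE {N k l : ℕ} (hN : Odd N) (hk : k ≤ l) (hl : l < N)
    (hkl : Even (l - k)) : stringGE N k * stringGE N l = stringBetween N k l := by
  rw [stringGE, stringGE, stringBetween, tensorOp_eq_siteTensor, tensorOp_eq_siteTensor,
    tensorOp_eq_siteTensor, siteTensor_mul]
  congr 1; funext i
  generalize lab i = j
  simp only [Nat.even_iff, Nat.odd_iff] at *
  split_ifs <;> first | (exfalso; omega) | simp [pauliX_mul_self, pauliZ_mul_self]

lemma basisWeight_nonneg {N : ℕ} (a : ℕ) (Φ : Conf N → ℂ) (s : Conf N) :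
    0 ≤ basisWeight a Φ s := sq_nonneg _

lemma sum_basisWeight {N ξ : ℕ} {Φ : Conf N → ℂ} (a : ℕ) (hΦ : IsSymmetricSRE ξ Φ) :
    ∑ s, basisWeight a Φ s = 1 := by
  obtain ⟨U, hU, rfl⟩ := hΦ.circuit
  have h := cexpval_diagOp a (U *ᵥ plusState N) fun _ => 1
  rw [diagOp_const] at h
  simp only [Complex.ofReal_one, one_smul, mul_one] at h
  rw [hU.cexpval_one] at h
  exact_mod_cast h.symm

/-- Bits far apart are independent, as far as functions to the left of `k` and to the right of `l`
are concerned. -/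
lemma sum_basisWeight_mul {N ξ : ℕ} {Φ : Conf N → ℂ} (a : ℕ) (hΦ : IsSymmetricSRE ξ Φ)
    {k l : ℕ} (hkl : k + 2 * ξ ≤ l) {f g : Conf N → ℝ} (hf : DependsOn f {i | lab i ≤ k})
    (hg : DependsOn g {i | l < lab i}) :
    ∑ s, basisWeight a Φ s * (f s * g s)
      = (∑ s, basisWeight a Φ s * f s) * ∑ s, basisWeight a Φ s * g s := by
  obtain ⟨U, hU, rfl⟩ := hΦ.circuit
  have h := hU.cexpval_mul (supportedOn_diagOp a hf) (supportedOn_diagOp a hg) hkl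
  rw [← diagOp_mul, cexpval_diagOp, cexpval_diagOp, cexpval_diagOp] at h
  exact_mod_cast h

/-- The string observables to the left of a gap are independent of those to the right of it. The
symmetry of the state is used to turn the strings on the left, which end at the site `N`, into
strings that end at the site `1`. -/
lemma stringGE_independent {N ξ a Δ m k : ℕ} {Φ : Conf N → ℂ} (hN : Odd N) (ha : 1 ≤ a)
    (hΔ : Even Δ) (hΔ0 : 0 < Δ) (hm : ∀ j, j < m → a + j * Δ < N) (hk : k < m)
    (hΦ : IsSymmetricSRE ξ Φ) (F G : (ℕ → ℝ) → ℝ)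
    (hF : ∀ u v : ℕ → ℝ, (∀ j, j + (ξ + 1) ≤ k → u j = v j) → F u = F v)
    (hG : ∀ u v : ℕ → ℝ, (∀ j, k ≤ j → j < m → u j = v j) → G u = G v) :
    ∑ s, basisWeight a Φ s * (F (fun j => signProd (stringSites N (a + j * Δ)) s) *
        G fun j => signProd (stringSites N (a + j * Δ)) s)
      = (∑ s, basisWeight a Φ s * F fun j => signProd (stringSites N (a + j * Δ)) s) *
        ∑ s, basisWeight a Φ s * G fun j => signProd (stringSites N (a + j * Δ)) s := by
  by_cases hkξ : ξ + 1 ≤ k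
  swap
  · have hc : ∀ u, F u = F 0 := fun u => hF u 0 fun j hj => by omega
    simp only [hc]
    rw [← Finset.sum_mul, sum_basisWeight a hΦ, one_mul, Finset.mul_sum]
    exact Finset.sum_congr rfl fun s _ => by ring
  have hχ : ∀ f : Conf N → ℝ, ∑ s, basisWeight a Φ s *
        (F (fun j => signProd (stringSites N (a + j * Δ)) s) * f s)
      = ∑ s, basisWeight a Φ s * (F (fun j => signProd (stringSites N (a + j * Δ)) s *
        signProd (symSites N a) s) * f s) := by
    intro f
    refine Finset.sum_congr rfl fun s _ => ?_
    rcases basisWeight_eq_zero_or (diagOp_symSites_mulVec hN a hΦ) s with h | h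
    · simp [h]
    · simp [h]
  rw [hχ]
  have h1 := hχ fun _ => 1
  simp only [mul_one] at h1
  rw [h1]
  obtain ⟨r, rfl⟩ := Nat.exists_eq_add_of_le' hkξ
  have hΔ2 : 2 ≤ Δ := by obtain ⟨c, rfl⟩ := hΔ; omega
  refine sum_basisWeight_mul a hΦ (k := a + r * Δ) (l := a + (r + (ξ + 1)) * Δ - 1) ?_ ?_ ?_
  · have : (r + (ξ + 1)) * Δ = r * Δ + (ξ + 1) * Δ := by ring
    have h3 : (ξ + 1) * 2 ≤ (ξ + 1) * Δ := Nat.mul_le_mul_left _ hΔ2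
    omega
  · intro s t hst
    refine hF _ _ fun j hj => ?_
    refine dependsOn_signProd_mul _ _ (S := {i | lab i ≤ a + r * Δ}) (fun i hi => ?_) hst
    have hjr : j * Δ ≤ r * Δ := Nat.mul_le_mul_right _ (by omega)
    have hjN := hm j (by omega)
    have hjE : Even (j * Δ) := hΔ.mul_left j
    simp only [Set.mem_ofPred_eq, not_le] at hi
    simp only [stringSites, symSites]
    generalize lab i = i at *
    generalize j * Δ = x at *
    split_ifs with hodd <;> simp only [Nat.even_iff, Nat.odd_iff] at * <;> omega
  · intro s t hst
    refine hG _ _ fun j hj hjm => ?_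
    refine dependsOn_signProd _ (S := {i | a + (r + (ξ + 1)) * Δ - 1 < lab i}) (fun i hi => ?_) hst
    have hjr : (r + (ξ + 1)) * Δ ≤ j * Δ := Nat.mul_le_mul_right _ hj
    have hjN := hm j hjm
    simp only [Set.mem_ofPred_eq]
    simp only [stringSites] at hi
    omega

/-! ### Moments of sums of weakly dependent variables -/

/-- The mean of `f` with respect to the weights `p`. -/
def wmean {Ω : Type*} [Fintype Ω] (p f : Ω → ℝ) : ℝ := ∑ s, p s * f s

/-- Centred variables `Y 0, …, Y (m - 1)`, bounded by `2`, on a finite probability space, such that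
`Y 0, …, Y (k - w)` are independent of `Y k, …, Y (m - 1)`. -/
structure IsWeaklyDependent {Ω : Type*} [Fintype Ω] (p : Ω → ℝ) (Y : ℕ → Ω → ℝ) (w m : ℕ) :
    Prop where
  nonneg : ∀ s, 0 ≤ p s
  total : ∑ s, p s = 1
  one_le : 1 ≤ w
  bound : ∀ j s, |Y j s| ≤ 2
  mean : ∀ j, j < m → wmean p (Y j) = 0
  indep : ∀ k, k < m → ∀ F G : (ℕ → ℝ) → ℝ,
    (∀ u v : ℕ → ℝ, (∀ j, j + w ≤ k → u j = v j) → F u = F v) →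
    (∀ u v : ℕ → ℝ, (∀ j, k ≤ j → j < m → u j = v j) → G u = G v) →
    wmean p (fun s => F (fun j => Y j s) * G fun j => Y j s)
      = wmean p (fun s => F fun j => Y j s) * wmean p fun s => G fun j => Y j s

/-- The partial sum of the first `k` variables. -/
def partialSum {Ω : Type*} (Y : ℕ → Ω → ℝ) (k : ℕ) (s : Ω) : ℝ := ∑ j ∈ range k, Y j s

/-- The variables between the independent past of `Y k` and `Y k`, summed up. -/
def windowSum {Ω : Type*} (Y : ℕ → Ω → ℝ) (w k : ℕ) (s : Ω) : ℝ := ∑ j ∈ Ico (k + 1 - w) k, Y j s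

namespace IsWeaklyDependent

variable {Ω : Type*} [Fintype Ω] {p : Ω → ℝ} {Y : ℕ → Ω → ℝ} {w m : ℕ}

lemma wmean_mono (h : IsWeaklyDependent p Y w m) {f g : Ω → ℝ} (hfg : ∀ s, f s ≤ g s) :
    wmean p f ≤ wmean p g :=
  Finset.sum_le_sum fun s _ => mul_le_mul_of_nonneg_left (hfg s) (h.nonneg s)

lemma wmean_const (h : IsWeaklyDependent p Y w m) (c : ℝ) : wmean p (fun _ => c) = c := by
  rw [wmean, ← Finset.sum_mul, h.total, one_mul]

lemma abs_wmean_le (h : IsWeaklyDependent p Y w m) {f g : Ω → ℝ} (hfg : ∀ s, |f s| ≤ g s) :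
    |wmean p f| ≤ wmean p g := by
  refine (Finset.abs_sum_le_sum_abs _ _).trans (Finset.sum_le_sum fun s _ => ?_)
  rw [abs_mul, abs_of_nonneg (h.nonneg s)]
  exact mul_le_mul_of_nonneg_left (hfg s) (h.nonneg s)

lemma abs_wmean_le_const (h : IsWeaklyDependent p Y w m) {f : Ω → ℝ} {c : ℝ}
    (hfg : ∀ s, |f s| ≤ c) : |wmean p f| ≤ c :=
  (h.abs_wmean_le hfg).trans_eq (h.wmean_const c)

lemma partialSum_eq (h : IsWeaklyDependent p Y w m) (k : ℕ) (s : Ω) :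
    partialSum Y k s = partialSum Y (k + 1 - w) s + windowSum Y w k s := by
  have := h.one_le
  rw [partialSum, partialSum, windowSum, Finset.range_eq_Ico, Finset.range_eq_Ico,
    Finset.sum_Ico_consecutive _ (Nat.zero_le _) (by omega)]

lemma abs_windowSum_le (h : IsWeaklyDependent p Y w m) (k : ℕ) (s : Ω) :
    |windowSum Y w k s| ≤ 2 * w := by
  refine (Finset.abs_sum_le_sum_abs _ _).trans
    ((Finset.sum_le_card_nsmul _ _ 2 fun j _ => h.bound j s).trans ?_)
  rw [nsmul_eq_mul, Nat.card_Ico]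
  have : ((k - (k + 1 - w) : ℕ) : ℝ) ≤ w := by exact_mod_cast (by omega)
  linarith

lemma wmean_past_mul (h : IsWeaklyDependent p Y w m) {k : ℕ} (hk : k < m) (r q : ℕ) :
    wmean p (fun s => partialSum Y (k + 1 - w) s ^ r * Y k s ^ q)
      = wmean p (fun s => partialSum Y (k + 1 - w) s ^ r) * wmean p fun s => Y k s ^ q := by
  refine h.indep k hk (fun u => (∑ j ∈ range (k + 1 - w), u j) ^ r) (fun u => u k ^ q) ?_ ?_
  · intro u v huv
    have := h.one_le
    rw [Finset.sum_congr rfl fun j hj => huv j (by have := Finset.mem_range.mp hj; omega)]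
  · intro u v huv
    rw [huv k le_rfl hk]

lemma wmean_past_mul_window (h : IsWeaklyDependent p Y w m) {k : ℕ} (hk : k < m) (r : ℕ) :
    wmean p (fun s => partialSum Y (k + 1 - w + 1 - w) s ^ r * (windowSum Y w k s * Y k s))
      = wmean p (fun s => partialSum Y (k + 1 - w + 1 - w) s ^ r) *
        wmean p fun s => windowSum Y w k s * Y k s := by
  have h1 := h.one_le
  refine h.indep (k + 1 - w) (by omega) (fun u => (∑ j ∈ range (k + 1 - w + 1 - w), u j) ^ r)
    (fun u => (∑ j ∈ Ico (k + 1 - w) k, u j) * u k) ?_ ?_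
  · intro u v huv
    rw [Finset.sum_congr rfl fun j hj => huv j (by have := Finset.mem_range.mp hj; omega)]
  · intro u v huv
    rw [huv k (by omega) hk, Finset.sum_congr rfl fun j hj => huv j (Finset.mem_Ico.mp hj).1
      ((Finset.mem_Ico.mp hj).2.trans hk)]

lemma wmean_past_mul_self (h : IsWeaklyDependent p Y w m) {k : ℕ} (hk : k < m) (r : ℕ) :
    wmean p (fun s => partialSum Y (k + 1 - w) s ^ r * Y k s) = 0 := by
  have := h.wmean_past_mul hk r 1
  simp only [pow_one] at this
  rw [this, h.mean k hk, mul_zero]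

lemma wmean_partialSum (h : IsWeaklyDependent p Y w m) {k : ℕ} (hk : k ≤ m) :
    wmean p (partialSum Y k) = 0 := by
  simp only [wmean, partialSum, Finset.mul_sum]
  rw [Finset.sum_comm]
  exact Finset.sum_eq_zero fun j hj => h.mean j ((Finset.mem_range.mp hj).trans_le hk)

lemma abs_wmean_window_mul (h : IsWeaklyDependent p Y w m) (k : ℕ) :
    |wmean p fun s => windowSum Y w k s * Y k s| ≤ 4 * w := by
  refine h.abs_wmean_le_const fun s => ?_
  rw [abs_mul]
  calc _ ≤ 2 * (w : ℝ) * 2 := mul_le_mul (h.abs_windowSum_le k s) (h.bound k s) (abs_nonneg _)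
        (by positivity)
    _ = _ := by ring

lemma wmean_sq_le (h : IsWeaklyDependent p Y w m) {k : ℕ} (hk : k ≤ m) :
    wmean p (fun s => partialSum Y k s ^ 2) ≤ 12 * w * k := by
  induction k with
  | zero => simp [partialSum, wmean]
  | succ k ih =>
    have ih := ih (by omega)
    have hw : (1 : ℝ) ≤ w := by exact_mod_cast h.one_le
    have e : wmean p (fun s => partialSum Y (k + 1) s ^ 2)
        = wmean p (fun s => partialSum Y k s ^ 2)
          + 2 * wmean p (fun s => partialSum Y (k + 1 - w) s ^ 1 * Y k s)
          + 2 * wmean p (fun s => windowSum Y w k s * Y k s)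
          + wmean p fun s => Y k s ^ 2 := by
      simp only [wmean, Finset.mul_sum, ← Finset.sum_add_distrib]
      refine Finset.sum_congr rfl fun s _ => ?_
      have h1 : partialSum Y (k + 1) s = partialSum Y k s + Y k s := Finset.sum_range_succ _ _
      rw [h1, h.partialSum_eq k s]
      ring
    rw [h.wmean_past_mul_self hk] at e
    have h1 := abs_le.mp (h.abs_wmean_window_mul k)
    have h2 : wmean p (fun s => Y k s ^ 2) ≤ 4 := by
      refine (le_abs_self _).trans (h.abs_wmean_le_const fun s => ?_)
      rw [abs_pow]
      nlinarith [h.bound k s, abs_nonneg (Y k s)]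
    push_cast
    nlinarith

/-- The third moment grows at most linearly. In `E[(S + Y k)³ - S³]`, the part of the partial sum `S`
that is independent of `Y k`, or of the product of `Y k` and the window before it, only enters
through vanishing means; what remains is bounded by a power of the window length. -/
lemma abs_wmean_cube_le (h : IsWeaklyDependent p Y w m) {k : ℕ} (hk : k ≤ m) :
    |wmean p fun s => partialSum Y k s ^ 3| ≤ 104 * w ^ 2 * k := by
  induction k with
  | zero => simp [partialSum, wmean]
  | succ k ih =>
    have ih := ih (by omega)
    have hw : (1 : ℝ) ≤ w := by exact_mod_cast h.one_le
    set A := partialSum Y (k + 1 - w)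
    set A' := partialSum Y (k + 1 - w + 1 - w)
    set B := windowSum Y w k
    set B' := windowSum Y w (k + 1 - w)
    set rem : Ω → ℝ := fun s => 6 * (B' s * B s * Y k s) + 3 * (B s ^ 2 * Y k s)
      + 3 * (B s * Y k s ^ 2) + Y k s ^ 3
    have e : wmean p (fun s => partialSum Y (k + 1) s ^ 3)
        = wmean p (fun s => partialSum Y k s ^ 3)
          + 3 * wmean p (fun s => A s ^ 2 * Y k s)
          + 6 * wmean p (fun s => A' s ^ 1 * (B s * Y k s))
          + 3 * wmean p (fun s => A s ^ 1 * Y k s ^ 2)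
          + wmean p rem := by
      simp only [wmean, Finset.mul_sum, ← Finset.sum_add_distrib]
      refine Finset.sum_congr rfl fun s _ => ?_
      have h1 : partialSum Y (k + 1) s = partialSum Y k s + Y k s := Finset.sum_range_succ _ _
      have h2 : partialSum Y k s = A s + B s := h.partialSum_eq k s
      have h3 : A s = A' s + B' s := h.partialSum_eq _ s
      rw [h1, h2]
      simp only [rem]
      linear_combination (6 * p s * B s * Y k s) * h3
    have z2 : wmean p (fun s => A' s ^ 1 * (B s * Y k s)) = 0 := by
      rw [h.wmean_past_mul_window hk 1]
      simp only [pow_one]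
      rw [h.wmean_partialSum (by have := h.one_le; omega), zero_mul]
    have z3 : wmean p (fun s => A s ^ 1 * Y k s ^ 2) = 0 := by
      rw [h.wmean_past_mul hk 1 2]
      simp only [pow_one]
      rw [h.wmean_partialSum (by have := h.one_le; omega), zero_mul]
    rw [h.wmean_past_mul_self hk, z2, z3] at e
    have hrem : |wmean p rem| ≤ 104 * w ^ 2 := by
      refine h.abs_wmean_le_const fun s => ?_
      have hB := h.abs_windowSum_le k s
      have hB' := h.abs_windowSum_le (k + 1 - w) s
      have hY := h.bound k s
      have t1 : |B' s * B s * Y k s| ≤ 2 * w * (2 * w) * 2 := by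
        rw [abs_mul, abs_mul]; gcongr
      have t2 : |B s ^ 2 * Y k s| ≤ (2 * w) ^ 2 * 2 := by
        rw [abs_mul, abs_pow]; gcongr
      have t3 : |B s * Y k s ^ 2| ≤ 2 * w * 2 ^ 2 := by
        rw [abs_mul, abs_pow]; gcongr
      have t4 : |Y k s ^ 3| ≤ 2 ^ 3 := by
        rw [abs_pow]; gcongr
      rw [abs_le] at *
      constructor <;> simp only [rem] <;> nlinarith
    rw [e]
    push_cast
    rw [abs_le] at *
    constructor <;> nlinarith

/-- The fourth moment grows at most quadratically: its increments are controlled by second moments,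
which grow linearly, because the cubes of the independent past of `Y k` decouple. -/
lemma wmean_pow_four_le (h : IsWeaklyDependent p Y w m) {k : ℕ} (hk : k ≤ m) :
    wmean p (fun s => partialSum Y k s ^ 4) ≤ 2784 * w ^ 3 * k ^ 2 := by
  induction k with
  | zero => simp [partialSum, wmean]
  | succ k ih =>
    have ih := ih (by omega)
    have hw : (1 : ℝ) ≤ w := by exact_mod_cast h.one_le
    have hw1 := h.one_le
    set A := partialSum Y (k + 1 - w)
    set A' := partialSum Y (k + 1 - w + 1 - w)
    set B := windowSum Y w k
    set B' := windowSum Y w (k + 1 - w)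
    set S := partialSum Y k
    -- the part of the increment without the two terms that decouple
    set rem : Ω → ℝ := fun s => 24 * (A' s * (B' s * B s * Y k s))
      + 12 * (B' s ^ 2 * B s * Y k s) + 12 * (A s * (B s ^ 2 * Y k s)) + 4 * (B s ^ 3 * Y k s)
      + 6 * (S s ^ 2 * Y k s ^ 2) + 4 * (S s * Y k s ^ 3) + Y k s ^ 4
    have e : wmean p (fun s => partialSum Y (k + 1) s ^ 4)
        = wmean p (fun s => S s ^ 4)
          + 4 * wmean p (fun s => A s ^ 3 * Y k s)
          + 12 * wmean p (fun s => A' s ^ 2 * (B s * Y k s))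
          + wmean p rem := by
      simp only [wmean, Finset.mul_sum, ← Finset.sum_add_distrib]
      refine Finset.sum_congr rfl fun s _ => ?_
      have h1 : partialSum Y (k + 1) s = S s + Y k s := Finset.sum_range_succ _ _
      have h2 : S s = A s + B s := h.partialSum_eq k s
      have h3 : A s = A' s + B' s := h.partialSum_eq _ s
      rw [h1]
      simp only [rem]
      rw [h2]
      linear_combination (12 * p s * B s * Y k s * (A s + A' s + B' s)) * h3
    rw [h.wmean_past_mul_self hk, h.wmean_past_mul_window hk 2] at e
    have hkr : (0 : ℝ) ≤ k := Nat.cast_nonneg k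
    have hA : wmean p (fun s => A s ^ 2) ≤ 12 * w * k := by
      refine (h.wmean_sq_le (by omega)).trans ?_
      gcongr; omega
    have hA' : wmean p (fun s => A' s ^ 2) ≤ 12 * w * k := by
      refine (h.wmean_sq_le (by omega)).trans ?_
      gcongr; omega
    have hA'0 : 0 ≤ wmean p (fun s => A' s ^ 2) :=
      Finset.sum_nonneg fun s _ => mul_nonneg (h.nonneg s) (sq_nonneg _)
    have hS : wmean p (fun s => S s ^ 2) ≤ 12 * w * k := h.wmean_sq_le (by omega)
    have hBY : wmean p (fun s => A' s ^ 2) * wmean p (fun s => B s * Y k s)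
        ≤ 12 * w * k * (4 * w) :=
      (mul_le_mul_of_nonneg_left ((le_abs_self _).trans (h.abs_wmean_window_mul k)) hA'0).trans
        (mul_le_mul_of_nonneg_right hA' (by positivity))
    have hrem : wmean p rem ≤ 96 * w ^ 2 * wmean p (fun s => A' s ^ 2)
        + 48 * w ^ 2 * wmean p (fun s => A s ^ 2) + 40 * wmean p (fun s => S s ^ 2)
        + (144 * w ^ 2 + 256 * w ^ 3 + 32) := by
      have e2 : 96 * w ^ 2 * wmean p (fun s => A' s ^ 2)
        + 48 * w ^ 2 * wmean p (fun s => A s ^ 2) + 40 * wmean p (fun s => S s ^ 2)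
        + (144 * w ^ 2 + 256 * w ^ 3 + 32)
        = wmean p fun s => 96 * w ^ 2 * A' s ^ 2 + 48 * w ^ 2 * A s ^ 2 + 40 * S s ^ 2
          + (144 * w ^ 2 + 256 * w ^ 3 + 32) := by
        conv_lhs => rw [← h.wmean_const (144 * w ^ 2 + 256 * w ^ 3 + 32)]
        simp only [wmean, Finset.mul_sum, ← Finset.sum_add_distrib]
        refine Finset.sum_congr rfl fun s _ => ?_
        ring
      rw [e2]
      refine h.wmean_mono fun s => ?_
      have hB := h.abs_windowSum_le k s
      have hB' := h.abs_windowSum_le (k + 1 - w) s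
      have hY := h.bound k s
      have am : ∀ x : ℝ, |x| ≤ (1 + x ^ 2) / 2 := fun x => by
        nlinarith [sq_nonneg (|x| - 1), sq_abs x]
      have t1 : |A' s * (B' s * B s * Y k s)| ≤ (1 + A' s ^ 2) / 2 * (2 * w * (2 * w) * 2) := by
        rw [abs_mul, abs_mul, abs_mul]; gcongr; exact am _
      have t2 : |B' s ^ 2 * B s * Y k s| ≤ (2 * w) ^ 2 * (2 * w) * 2 := by
        rw [abs_mul, abs_mul, abs_pow]; gcongr
      have t3 : |A s * (B s ^ 2 * Y k s)| ≤ (1 + A s ^ 2) / 2 * ((2 * w) ^ 2 * 2) := by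
        rw [abs_mul, abs_mul, abs_pow]; gcongr; exact am _
      have t4 : |B s ^ 3 * Y k s| ≤ (2 * w) ^ 3 * 2 := by
        rw [abs_mul, abs_pow]; gcongr
      have t5 : |S s ^ 2 * Y k s ^ 2| ≤ S s ^ 2 * 2 ^ 2 := by
        rw [abs_mul, abs_pow, abs_pow, sq_abs]; gcongr
      have t6 : |S s * Y k s ^ 3| ≤ (1 + S s ^ 2) / 2 * 2 ^ 3 := by
        rw [abs_mul, abs_pow]; gcongr; exact am _
      have t7 : |Y k s ^ 4| ≤ 2 ^ 4 := by
        rw [abs_pow]; gcongr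
      have t1 := (abs_le.mp t1).2
      have t2 := (abs_le.mp t2).2
      have t3 := (abs_le.mp t3).2
      have t4 := (abs_le.mp t4).2
      have t5 := (abs_le.mp t5).2
      have t6 := (abs_le.mp t6).2
      have t7 := (abs_le.mp t7).2
      simp only [rem]
      linarith
    have hw2 : (w : ℝ) ^ 2 ≤ w ^ 3 := pow_le_pow_right₀ hw (by norm_num)
    have hw3 : (w : ℝ) ≤ w ^ 3 := by simpa using pow_le_pow_right₀ hw (show 1 ≤ 3 by norm_num)
    have hwk : (w : ℝ) ^ 2 * k ≤ w ^ 3 * k := by gcongr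
    have hwk' : (w : ℝ) * k ≤ w ^ 3 * k := by gcongr
    have b1 : 96 * w ^ 2 * wmean p (fun s => A' s ^ 2) ≤ 96 * w ^ 2 * (12 * w * k) := by gcongr
    have b2 : 48 * w ^ 2 * wmean p (fun s => A s ^ 2) ≤ 48 * w ^ 2 * (12 * w * k) := by gcongr
    rw [e]
    push_cast
    nlinarith

/-- The variance of the sum, up to an error bounded uniformly in the number of terms. -/
lemma abs_variance_sub_le (h : IsWeaklyDependent p Y w m) (c : ℕ → ℝ)
    (hc : ∀ i j, i ≤ j → j < m → wmean p (fun s => Y i s * Y j s) = c (j - i)) :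
    |m * (c 0 + 2 * ∑ j ∈ Icc 1 (m - 1), c j) - wmean p fun s => partialSum Y m s ^ 2|
      ≤ 8 * w ^ 2 := by
  have hV : ∀ k, k ≤ m → wmean p (fun s => partialSum Y k s ^ 2)
      = ∑ i ∈ range k, (c 0 + 2 * ∑ j ∈ Icc 1 i, c j) := by
    intro k
    induction k with
    | zero => intro _; simp [partialSum, wmean]
    | succ k ih =>
      intro hk
      have e : wmean p (fun s => partialSum Y (k + 1) s ^ 2)
          = wmean p (fun s => partialSum Y k s ^ 2) +
            (wmean p (fun s => Y k s * Y k s) +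
              2 * ∑ j ∈ range k, wmean p fun s => Y j s * Y k s) := by
        simp only [wmean]
        rw [Finset.sum_comm, Finset.mul_sum, ← Finset.sum_add_distrib, ← Finset.sum_add_distrib]
        refine Finset.sum_congr rfl fun s _ => ?_
        have h1 : partialSum Y (k + 1) s = partialSum Y k s + Y k s := Finset.sum_range_succ _ _
        rw [← Finset.mul_sum, ← Finset.sum_mul, h1]
        simp only [partialSum]
        ring
      rw [e, ih (by omega), Finset.sum_range_succ, hc k k le_rfl hk, Nat.sub_self]
      congr 3
      rw [Finset.sum_congr rfl fun j hj => hc j k (Finset.mem_range.mp hj).le hk]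
      refine Finset.sum_nbij' (fun j => k - j) (fun j => k - j) ?_ ?_ ?_ ?_ ?_ <;>
        intro j hj <;> simp only [Finset.mem_range, Finset.mem_Icc] at * <;> first | rfl | omega
  have hcw : ∀ j, w ≤ j → j < m → c j = 0 := by
    intro j hj hjm
    have h1 := h.one_le
    rw [← Nat.sub_zero j, ← hc 0 j (Nat.zero_le _) hjm]
    have := h.indep j hjm (fun u => u 0) (fun u => u j)
      (fun u v huv => huv 0 (by omega)) (fun u v huv => huv j le_rfl hjm)
    rw [this, h.mean j hjm, mul_zero]
  have hcb : ∀ j, j < m → |c j| ≤ 4 := by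
    intro j hjm
    rw [← Nat.sub_zero j, ← hc 0 j (Nat.zero_le _) hjm]
    refine h.abs_wmean_le_const fun s => ?_
    rw [abs_mul]
    calc _ ≤ (2 : ℝ) * 2 := mul_le_mul (h.bound _ s) (h.bound _ s) (abs_nonneg _) (by norm_num)
      _ = 4 := by norm_num
  have htail : ∀ i ∈ range m, |c 0 + 2 * ∑ j ∈ Icc 1 (m - 1), c j - (c 0 + 2 * ∑ j ∈ Icc 1 i, c j)|
      ≤ if i < w then 8 * (w : ℝ) else 0 := by
    intro i hi
    have hi := Finset.mem_range.mp hi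
    have hsub : Icc 1 i ⊆ Icc 1 (m - 1) := Finset.Icc_subset_Icc_right (by omega)
    rw [← Finset.sum_sdiff hsub]
    have e : c 0 + 2 * (∑ j ∈ Icc 1 (m - 1) \ Icc 1 i, c j + ∑ j ∈ Icc 1 i, c j)
        - (c 0 + 2 * ∑ j ∈ Icc 1 i, c j) = 2 * ∑ j ∈ Icc 1 (m - 1) \ Icc 1 i, c j := by ring
    rw [e, abs_mul, abs_two]
    have hle : |∑ j ∈ Icc 1 (m - 1) \ Icc 1 i, c j|
        ≤ ∑ j ∈ Icc 1 (m - 1) \ Icc 1 i, if j < w then (4 : ℝ) else 0 := by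
      refine (Finset.abs_sum_le_sum_abs _ _).trans (Finset.sum_le_sum fun j hj => ?_)
      simp only [Finset.mem_sdiff, Finset.mem_Icc] at hj
      split_ifs with hjw
      · exact hcb j (by omega)
      · rw [hcw j (by omega) (by omega), abs_zero]
    split_ifs with hiw
    · have : ∑ j ∈ Icc 1 (m - 1) \ Icc 1 i, (if j < w then (4 : ℝ) else 0) ≤ 4 * w := by
        rw [← Finset.sum_filter, Finset.sum_const, nsmul_eq_mul, mul_comm]
        have hcard : ((Icc 1 (m - 1) \ Icc 1 i).filter (· < w)).card ≤ w := by
          rw [← Finset.card_range w]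
          refine Finset.card_le_card fun j hj => ?_
          exact Finset.mem_range.mpr (by simpa using (Finset.mem_filter.mp hj).2)
        have : (((Icc 1 (m - 1) \ Icc 1 i).filter (· < w)).card : ℝ) ≤ w := by exact_mod_cast hcard
        linarith
      linarith
    · have : ∑ j ∈ Icc 1 (m - 1) \ Icc 1 i, (if j < w then (4 : ℝ) else 0) = 0 := by
        refine Finset.sum_eq_zero fun j hj => if_neg ?_
        simp only [Finset.mem_sdiff, Finset.mem_Icc] at hj
        omega
      linarith
  have e : m * (c 0 + 2 * ∑ j ∈ Icc 1 (m - 1), c j) = ∑ _i ∈ range m,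
      (c 0 + 2 * ∑ j ∈ Icc 1 (m - 1), c j) := by
    rw [Finset.sum_const, Finset.card_range, nsmul_eq_mul]
  rw [hV m le_rfl, e, ← Finset.sum_sub_distrib]
  refine (Finset.abs_sum_le_sum_abs _ _).trans ((Finset.sum_le_sum htail).trans ?_)
  rw [← Finset.sum_filter, Finset.sum_const, nsmul_eq_mul]
  have hcard : ((range m).filter (· < w)).card ≤ w := by
    refine (Finset.card_le_card (t := range w) fun j hj => ?_).trans_eq (Finset.card_range w)
    exact Finset.mem_range.mpr (Finset.mem_filter.mp hj).2
  have : (((range m).filter (· < w)).card : ℝ) ≤ w := by exact_mod_cast hcard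
  nlinarith [Nat.cast_nonneg (α := ℝ) w]

end IsWeaklyDependent

/-! ### Expansion of the characteristic function -/

lemma abs_cos_sub_le (x : ℝ) : |Real.cos x - (1 - x ^ 2 / 2)| ≤ 3 * x ^ 4 := by
  have h4 : |x| ^ 4 = x ^ 4 := by rw [← abs_pow, abs_of_nonneg (by positivity)]
  rcases le_total |x| 1 with hx | hx
  · refine (Real.cos_bound hx).trans ?_
    rw [h4]
    nlinarith [pow_nonneg (abs_nonneg x) 4]
  · have h1 := Real.one_sub_sq_div_two_le_cos (x := x)
    have h2 := Real.cos_le_one x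
    have h3 : 1 ≤ x ^ 2 := by rw [← sq_abs]; nlinarith
    rw [abs_le]
    constructor <;> nlinarith

lemma abs_sin_sub_le (x : ℝ) : |Real.sin x - (x - x ^ 3 / 6)| ≤ 3 * x ^ 4 := by
  have h4 : |x| ^ 4 = x ^ 4 := by rw [← abs_pow, abs_of_nonneg (by positivity)]
  rcases le_total |x| 1 with hx | hx
  · refine (Real.sin_bound hx).trans ?_
    have h5 : |x| ^ 5 ≤ |x| ^ 4 := pow_le_pow_of_le_one (abs_nonneg x) hx (by norm_num)
    nlinarith [pow_nonneg (abs_nonneg x) 4]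
  · have h1 : |Real.sin x| ≤ 1 := Real.abs_sin_le_one x
    have h2 : |x| ≤ |x| ^ 4 := by simpa using pow_le_pow_right₀ hx (show 1 ≤ 4 by norm_num)
    have h3 : |x| ^ 3 ≤ |x| ^ 4 := pow_le_pow_right₀ hx (by norm_num)
    have h5 : 1 ≤ |x| ^ 4 := one_le_pow₀ hx
    have h6 : |x ^ 3 / 6| = |x| ^ 3 / 6 := by rw [abs_div, abs_pow]; norm_num
    have h7 := abs_sub (Real.sin x) (x - x ^ 3 / 6)
    have h8 := abs_sub x (x ^ 3 / 6)
    rw [← h4]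
    linarith

/-- If `X` is centred, `|E e^{iX} - 1|` is half the variance, up to third and fourth moments. -/
lemma abs_two_mul_sqrt_sub_le {Ω : Type*} [Fintype Ω] {p X : Ω → ℝ} (hp : ∀ s, 0 ≤ p s)
    (hp1 : ∑ s, p s = 1) (hX : wmean p X = 0) :
    |2 * Real.sqrt ((wmean p (fun s => Real.cos (X s)) - 1) ^ 2
        + (wmean p fun s => Real.sin (X s)) ^ 2) - wmean p fun s => X s ^ 2|
      ≤ |wmean p fun s => X s ^ 3| / 3 + 12 * wmean p fun s => X s ^ 4 := by
  have hbd : ∀ f : Ω → ℝ, (∀ s, |f s| ≤ 3 * X s ^ 4) →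
      |wmean p f| ≤ 3 * wmean p fun s => X s ^ 4 := by
    intro f hf
    rw [wmean, wmean, Finset.mul_sum]
    refine (Finset.abs_sum_le_sum_abs _ _).trans (Finset.sum_le_sum fun s _ => ?_)
    rw [abs_mul, abs_of_nonneg (hp s)]
    calc _ ≤ p s * (3 * X s ^ 4) := mul_le_mul_of_nonneg_left (hf s) (hp s)
      _ = _ := by ring
  have hc : wmean p (fun s => Real.cos (X s)) - 1 = -(wmean p (fun s => X s ^ 2) / 2)
      + wmean p fun s => Real.cos (X s) - (1 - X s ^ 2 / 2) := by
    conv_lhs => rw [← hp1]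
    simp only [wmean, Finset.sum_div, ← Finset.sum_sub_distrib, ← Finset.sum_neg_distrib,
      ← Finset.sum_add_distrib]
    exact Finset.sum_congr rfl fun s _ => by ring
  have hs : wmean p (fun s => Real.sin (X s)) = wmean p X - wmean p (fun s => X s ^ 3) / 6
      + wmean p fun s => Real.sin (X s) - (X s - X s ^ 3 / 6) := by
    simp only [wmean, Finset.sum_div, ← Finset.sum_sub_distrib, ← Finset.sum_add_distrib]
    exact Finset.sum_congr rfl fun s _ => by ring
  have h1 := hbd _ fun s => abs_cos_sub_le (X s)
  have h2 := hbd _ fun s => abs_sin_sub_le (X s)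
  rw [hX] at hs
  have hcos : wmean p (fun s => Real.cos (X s)) ≤ 1 := by
    rw [← hp1]
    refine Finset.sum_le_sum fun s _ => ?_
    nlinarith [hp s, Real.cos_le_one (X s)]
  set u := wmean p (fun s => Real.cos (X s)) - 1
  set v := wmean p fun s => Real.sin (X s)
  have hlow : -u ≤ Real.sqrt (u ^ 2 + v ^ 2) := Real.le_sqrt_of_sq_le (by nlinarith [sq_nonneg v])
  have hup : Real.sqrt (u ^ 2 + v ^ 2) ≤ -u + |v| := by
    refine Real.sqrt_le_iff.mpr ⟨by have := abs_nonneg v; linarith, ?_⟩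
    nlinarith [abs_nonneg v, sq_abs v]
  have hv : |v| ≤ |wmean p fun s => X s ^ 3| / 6 + 3 * wmean p fun s => X s ^ 4 := by
    rw [hs]
    refine (abs_add_le _ _).trans (add_le_add (le_of_eq ?_) h2)
    rw [zero_sub, abs_neg, abs_div]; norm_num
  have h1 := abs_le.mp h1
  have hX4 : 0 ≤ wmean p fun s => X s ^ 4 :=
    Finset.sum_nonneg fun s _ => mul_nonneg (hp s) (by positivity)
  have h3 := abs_nonneg (wmean p fun s => X s ^ 3)
  rw [abs_le]
  constructor <;> linarith

/-! ### The implemented operation as an averaged rotation -/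

/-- The value of `K_{≥ a + jΔ}` in a basis vector of the sublattice basis. -/
def stringVal (N a Δ j : ℕ) (s : Conf N) : ℝ := signProd (stringSites N (a + j * Δ)) s

lemma stringVal_sq (N a Δ j : ℕ) (s : Conf N) : stringVal N a Δ j s ^ 2 = 1 := by
  rw [sq, stringVal, signProd_mul_self]

lemma stringVal_eq (N a Δ j : ℕ) (s : Conf N) :
    stringVal N a Δ j s = 1 ∨ stringVal N a Δ j s = -1 :=
  sq_eq_one_iff.mp (stringVal_sq N a Δ j s)

lemma stringGE_eq_diagOp_stringVal {N a Δ j : ℕ} (hN : Odd N) (hΔ : Even Δ)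
    (hj : a + j * Δ < N) : stringGE N (a + j * Δ) = diagOp a (stringVal N a Δ j) := by
  refine stringGE_eq_diagOp hN hj ?_
  have : a + (a + j * Δ) = 2 * a + j * Δ := by ring
  rw [this]
  exact (even_two_mul a).add (hΔ.mul_left j)

lemma rotMatrix_mul {A : Type*} [Ring A] (a : ℕ) (c S c' S' : A) :
    rotMatrix a c S * rotMatrix a c' S'
      = rotMatrix a (c * c' - S * S') (S * c' + c * S') := by
  unfold rotMatrix
  split_ifs <;> ext i j <;> fin_cases i <;> fin_cases j <;>
    simp [Matrix.mul_apply, Fin.sum_univ_three] <;> abel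

lemma rotMatrix_one_zero {A : Type*} [Ring A] (a : ℕ) : rotMatrix a (1 : A) 0 = 1 := by
  unfold rotMatrix
  split_ifs <;> ext i j <;> fin_cases i <;> fin_cases j <;> simp

/-- The rotations by the commuting angles `γ K_{≥ a + kΔ}` compose to a rotation by their sum. -/
lemma stepProduct_eq {N a Δ m : ℕ} (hN : Odd N) (hΔ : Even Δ) (γ : ℝ)
    (hm : ∀ j, j < m → a + j * Δ < N) :
    stepProduct N a Δ γ m
      = rotMatrix a (diagOp a fun s => Real.cos (γ * ∑ j ∈ range m, stringVal N a Δ j s))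
        (diagOp a fun s => Real.sin (γ * ∑ j ∈ range m, stringVal N a Δ j s)) := by
  induction m with
  | zero => simp [stepProduct, diagOp_const, rotMatrix_one_zero]
  | succ m ih =>
    have hc : ∀ s : Conf N, Real.cos (γ * stringVal N a Δ m s) = Real.cos γ := fun s => by
      rcases stringVal_eq N a Δ m s with h | h <;> simp [h]
    have hs : ∀ s : Conf N, Real.sin (γ * stringVal N a Δ m s)
        = Real.sin γ * stringVal N a Δ m s := fun s => by
      rcases stringVal_eq N a Δ m s with h | h <;> simp [h]
    have h1 : (Real.cos γ : ℂ) • (1 : Op N)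
        = diagOp a fun s => Real.cos (γ * stringVal N a Δ m s) := by
      rw [← diagOp_const a]; simp only [hc]
    have h2 : (Real.sin γ : ℂ) • stringGE N (a + m * Δ)
        = diagOp a fun s => Real.sin (γ * stringVal N a Δ m s) := by
      simp only [hs]
      rw [diagOp_mul, diagOp_const, smul_mul_assoc, one_mul,
        stringGE_eq_diagOp_stringVal hN hΔ (hm m (Nat.lt_succ_self m))]
    rw [stepProduct, ih fun j hj => hm j (by omega), h1, h2, rotMatrix_mul, ← diagOp_mul,
      ← diagOp_mul, ← diagOp_mul, ← diagOp_mul, sub_eq_add_neg, ← diagOp_neg, ← diagOp_add,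
      ← diagOp_add]
    congr 2 <;> funext s <;> rw [Finset.sum_range_succ, mul_add]
    · rw [Real.cos_add]; ring
    · rw [Real.sin_add]; ring

lemma expval_one {N ξ : ℕ} {Φ : Conf N → ℂ} (hΦ : IsSymmetricSRE ξ Φ) : expval Φ 1 = 1 := by
  obtain ⟨U, hU, rfl⟩ := hΦ.circuit
  rw [expval_eq_re, hU.cexpval_one, Complex.one_re]

lemma expval_zero {N : ℕ} (Φ : Conf N → ℂ) : expval Φ 0 = 0 := by simp [expval]

lemma expval_neg {N : ℕ} (Φ : Conf N → ℂ) (A : Op N) : expval Φ (-A) = -expval Φ A := by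
  simp [expval, Matrix.neg_mulVec]

lemma expval_rotMatrix {N ξ : ℕ} {Φ : Conf N → ℂ} (hΦ : IsSymmetricSRE ξ Φ) (a : ℕ) (c S : Op N) :
    (Matrix.of fun i j => expval Φ (rotMatrix a c S i j))
      = rotMatrix a (expval Φ c) (expval Φ S) := by
  unfold rotMatrix
  split_ifs <;> ext i j <;> fin_cases i <;> fin_cases j <;>
    simp [expval_one hΦ, expval_zero, expval_neg]

lemma logicalOp_eq {N ξ a Δ m : ℕ} {Φ : Conf N → ℂ} (hN : Odd N) (hΔ : Even Δ)
    (hΦ : IsSymmetricSRE ξ Φ) (γ : ℝ) (hm : ∀ j, j < m → a + j * Δ < N) :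
    logicalOp Φ a Δ m γ = rotMatrix a
      (wmean (basisWeight a Φ) fun s => Real.cos (γ * ∑ j ∈ range m, stringVal N a Δ j s))
      (wmean (basisWeight a Φ) fun s => Real.sin (γ * ∑ j ∈ range m, stringVal N a Δ j s)) := by
  rw [logicalOp, stepProduct_eq hN hΔ γ hm, expval_rotMatrix hΦ, expval_diagOp, expval_diagOp]
  rfl

lemma opDist_rotMatrix (a : ℕ) (c S c' S' : ℝ) :
    opDist (rotMatrix a c S) (rotMatrix a c' S')
      = 2 * Real.sqrt ((c - c') ^ 2 + (S - S') ^ 2) := by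
  have h : 2 * ((transferMatrix (rotMatrix a c S) - transferMatrix (rotMatrix a c' S'))ᴴ *
      (transferMatrix (rotMatrix a c S) - transferMatrix (rotMatrix a c' S'))).trace
      = 2 ^ 2 * ((c - c') ^ 2 + (S - S') ^ 2) := by
    unfold transferMatrix rotMatrix
    split_ifs <;>
      simp [Matrix.trace, Matrix.mul_apply, Fintype.sum_sum_type, Fin.sum_univ_three] <;> ring
  rw [opDist, h, Real.sqrt_mul (by positivity), Real.sqrt_sq (by norm_num)]

/-! ### Moments of the string operators -/

section Strings

variable {N ξ a n m Δ : ℕ} {Φ : Conf N → ℂ} {μ : ℝ} {K : ℕ → ℝ}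

lemma HasStringOrder.wmean_stringVal (hK : HasStringOrder Φ a n μ K) (hN : Odd N)
    (han : a + n < N) (hΔ : Even Δ) {j : ℕ} (hj : j * Δ ≤ n) :
    wmean (basisWeight a Φ) (stringVal N a Δ j) = μ := by
  rw [← hK.single (j * Δ) (hΔ.mul_left j) hj, stringGE_eq_diagOp_stringVal hN hΔ (by omega),
    expval_diagOp]
  rfl

lemma HasStringOrder.wmean_stringVal_mul (hK : HasStringOrder Φ a n μ K) (hN : Odd N)
    (han : a + n < N) (hΔ : Even Δ) {i j : ℕ} (hij : i ≤ j) (hj : j * Δ ≤ n) :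
    wmean (basisWeight a Φ) (fun s => stringVal N a Δ i s * stringVal N a Δ j s)
      = K ((j - i) * Δ) := by
  have hijΔ : i * Δ ≤ j * Δ := Nat.mul_le_mul_right _ hij
  rw [Nat.sub_mul, ← hK.pair (i * Δ) (j * Δ) (hΔ.mul_left i) (hΔ.mul_left j) hijΔ hj,
    ← stringGE_mul_stringGE hN (by omega) (by omega), stringGE_eq_diagOp_stringVal hN hΔ (by omega),
    stringGE_eq_diagOp_stringVal hN hΔ (by omega), ← diagOp_mul, expval_diagOp]
  · rfl
  · have : a + j * Δ - (a + i * Δ) = (j - i) * Δ := by rw [Nat.sub_mul]; omega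
    rw [this]
    exact hΔ.mul_left _

lemma HasStringOrder.abs_le_one (hK : HasStringOrder Φ a n μ K) (hN : Odd N)
    (han : a + n < N) (hΦ : IsSymmetricSRE ξ Φ) : |μ| ≤ 1 := by
  rw [← hK.wmean_stringVal hN han (Δ := 2) even_two (j := 0) (by omega),
    ← sum_basisWeight a hΦ]
  refine (Finset.abs_sum_le_sum_abs _ _).trans (Finset.sum_le_sum fun s _ => ?_)
  rw [abs_mul, abs_of_nonneg (basisWeight_nonneg a Φ s)]
  rcases stringVal_eq N a 2 0 s with h | h <;> simp [h]

lemma HasStringOrder.apply_zero (hK : HasStringOrder Φ a n μ K) (hN : Odd N)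
    (han : a + n < N) (hΦ : IsSymmetricSRE ξ Φ) : K 0 = 1 := by
  have h := hK.wmean_stringVal_mul hN han (Δ := 2) even_two (i := 0) (j := 0) le_rfl (by omega)
  simp only [Nat.sub_self, zero_mul, ← sq, stringVal_sq] at h
  rw [← h, wmean]
  simpa using (sum_basisWeight a hΦ)

/-- Over the whole region, longer than twice the entanglement range, the strings decouple. -/
lemma HasStringOrder.apply_length (hK : HasStringOrder Φ a n μ K) (hN : Odd N) (ha : 1 ≤ a)
    (han : a + n < N) (hΦ : IsSymmetricSRE ξ Φ) (hn : Even n) (hξ : 2 * ξ < n) : K n = μ ^ 2 := by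
  obtain ⟨r, rfl⟩ := hn
  have h := stringGE_independent (Δ := 2) (m := r + 1) (k := r) hN ha even_two two_pos
    (fun j hj => by omega) (Nat.lt_succ_self r) hΦ (fun u => u 0) (fun u => u r)
    (fun u v huv => huv 0 (by omega)) (fun u v huv => huv r le_rfl (Nat.lt_succ_self r))
  have h1 := hK.wmean_stringVal_mul hN han (Δ := 2) even_two (Nat.zero_le r) (by omega)
  have h2 := hK.wmean_stringVal hN han (Δ := 2) even_two (j := 0) (by omega)
  have h3 := hK.wmean_stringVal hN han (Δ := 2) even_two (j := r) (by omega)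
  have e : r + r = (r - 0) * 2 := by omega
  rw [e, ← h1, sq]
  nth_rewrite 1 [← h2]
  rw [← h3]
  exact h

lemma isWeaklyDependent_stringVal (hK : HasStringOrder Φ a n μ K) (hN : Odd N) (ha : 1 ≤ a)
    (han : a + n < N) (hΦ : IsSymmetricSRE ξ Φ) (hΔ : Even Δ) (hΔ0 : 0 < Δ) (hm : m * Δ = n) :
    IsWeaklyDependent (basisWeight a Φ) (fun j s => stringVal N a Δ j s - μ) (ξ + 1) m where
  nonneg := basisWeight_nonneg a Φ
  total := sum_basisWeight a hΦ
  one_le := by omega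
  bound j s := by
    have h1 := abs_le.mp (hK.abs_le_one hN han hΦ)
    rw [abs_le]
    rcases stringVal_eq N a Δ j s with h | h <;> rw [h] <;> constructor <;> linarith
  mean j hj := by
    have hjΔ : j * Δ ≤ n := hm ▸ Nat.mul_le_mul_right _ hj.le
    have := hK.wmean_stringVal hN han hΔ hjΔ
    simp only [wmean, mul_sub, Finset.sum_sub_distrib, ← Finset.sum_mul,
      sum_basisWeight a hΦ] at this ⊢
    rw [this, one_mul, sub_self]
  indep k hk F G hF hG :=
    stringGE_independent hN ha hΔ hΔ0
      (fun j hj => by have : j * Δ ≤ n := hm ▸ Nat.mul_le_mul_right _ hj.le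
                      omega) hk hΦ
      (fun u => F fun j => u j - μ) (fun u => G fun j => u j - μ)
      (fun u v huv => hF _ _ fun j hj => by rw [huv j hj])
      (fun u v huv => hG _ _ fun j hj hjm => by rw [huv j hj hjm])

lemma HasStringOrder.wmean_centred_mul (hK : HasStringOrder Φ a n μ K) (hN : Odd N)
    (han : a + n < N) (hΦ : IsSymmetricSRE ξ Φ) (hΔ : Even Δ) {i j : ℕ} (hij : i ≤ j)
    (hj : j * Δ ≤ n) :
    wmean (basisWeight a Φ) (fun s => (stringVal N a Δ i s - μ) * (stringVal N a Δ j s - μ))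
      = K ((j - i) * Δ) - μ ^ 2 := by
  have e : wmean (basisWeight a Φ) (fun s => (stringVal N a Δ i s - μ) * (stringVal N a Δ j s - μ))
      = wmean (basisWeight a Φ) (fun s => stringVal N a Δ i s * stringVal N a Δ j s)
        - μ * wmean (basisWeight a Φ) (stringVal N a Δ i)
        - μ * wmean (basisWeight a Φ) (stringVal N a Δ j)
        + μ ^ 2 * ∑ s, basisWeight a Φ s := by
    simp only [wmean, Finset.mul_sum, ← Finset.sum_sub_distrib, ← Finset.sum_add_distrib]
    exact Finset.sum_congr rfl fun s _ => by ring
  rw [e, hK.wmean_stringVal_mul hN han hΔ hij hj, hK.wmean_stringVal hN han hΔ hj,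
    hK.wmean_stringVal hN han hΔ ((Nat.mul_le_mul_right _ hij).trans hj), sum_basisWeight a hΦ]
  ring

/-- Deterministic strings have no fluctuations. -/
lemma HasStringOrder.eq_of_sq_eq_one (hK : HasStringOrder Φ a n μ K) (hN : Odd N)
    (han : a + n < N) (hΦ : IsSymmetricSRE ξ Φ) (hμ : μ ^ 2 = 1) (hΔ : Even Δ) {j : ℕ}
    (hj : j * Δ ≤ n) : K (j * Δ) = μ ^ 2 := by
  have h0 := hK.wmean_centred_mul hN han hΦ hΔ (le_refl 0) (by omega)
  have h1 := hK.wmean_centred_mul hN han hΦ hΔ (Nat.zero_le j) hj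
  simp only [Nat.sub_self, zero_mul, Nat.sub_zero, hK.apply_zero hN han hΦ, hμ, sub_self] at h0 h1
  rw [hμ, ← sub_eq_zero, ← h1]
  refine Finset.sum_eq_zero fun s _ => ?_
  have := (Finset.sum_eq_zero_iff_of_nonneg fun s _ =>
    mul_nonneg (basisWeight_nonneg a Φ s) (mul_self_nonneg _)).mp h0 s (Finset.mem_univ s)
  rcases mul_eq_zero.mp this with h | h
  · rw [h, zero_mul]
  · simp only [mul_self_eq_zero.mp h, zero_mul, mul_zero]

/-! ### The logical error to leading order -/

lemma HasStringOrder.leadingError_eq (hK : HasStringOrder Φ a n μ K) (hN : Odd N)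
    (han : a + n < N) (hΦ : IsSymmetricSRE ξ Φ) (hμ : μ ≠ 0) (hΔ : Even Δ) (hm0 : 0 < m)
    (hm : m * Δ = n) (β : ℝ) :
    leadingError β μ K Δ m = splitAngle β μ m ^ 2 *
      (m * ((K (0 * Δ) - μ ^ 2) + 2 * ∑ j ∈ Icc 1 (m - 1), (K (j * Δ) - μ ^ 2))) := by
  have hmr : (m : ℝ) ≠ 0 := by exact_mod_cast hm0.ne'
  rw [zero_mul, hK.apply_zero hN han hΦ, leadingError, kappa, splitAngle]
  by_cases h1 : μ ^ 2 = 1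
  · have hz : ∑ j ∈ Icc 1 (m - 1), (K (j * Δ) - μ ^ 2) = 0 := by
      refine Finset.sum_eq_zero fun j hj => ?_
      have hjm : j ≤ m := by have := Finset.mem_Icc.mp hj; omega
      rw [hK.eq_of_sq_eq_one hN han hΦ h1 hΔ (hm ▸ Nat.mul_le_mul_right _ hjm), sub_self]
    rw [hz, h1]
    simp
  · have h2 : 1 - μ ^ 2 ≠ 0 := fun h => h1 (by linarith)
    simp only [corrF]
    rw [← Finset.sum_div]
    field_simp

/-- The distance of the averaged rotation from the ideal one only involves the deviation of the
strings from their mean. -/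
lemma logicalError_eq (hN : Odd N) (hΔ : Even Δ) (hΦ : IsSymmetricSRE ξ Φ)
    (hm : ∀ j, j < m → a + j * Δ < N) (hm0 : 0 < m) (hμ : μ ≠ 0) (β : ℝ) :
    logicalError Φ a β μ Δ m = 2 * Real.sqrt
      ((wmean (basisWeight a Φ) (fun s => Real.cos (splitAngle β μ m *
          partialSum (fun j s => stringVal N a Δ j s - μ) m s)) - 1) ^ 2 +
        (wmean (basisWeight a Φ) fun s => Real.sin (splitAngle β μ m *
          partialSum (fun j s => stringVal N a Δ j s - μ) m s)) ^ 2) := by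
  have hmr : (m : ℝ) ≠ 0 := by exact_mod_cast hm0.ne'
  rw [logicalError, logicalOp_eq hN hΔ hΦ _ hm, opDist_rotMatrix]
  congr 2
  set p := basisWeight a Φ
  set X : Conf N → ℝ := fun s => splitAngle β μ m *
    partialSum (fun j s => stringVal N a Δ j s - μ) m s
  have hsplit : ∀ s : Conf N, splitAngle β μ m * ∑ j ∈ range m, stringVal N a Δ j s
      = X s + β := by
    intro s
    simp only [X, partialSum, Finset.sum_sub_distrib, Finset.sum_const, Finset.card_range,
      nsmul_eq_mul, splitAngle]
    field_simp
    ring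
  simp only [hsplit, Real.cos_add, Real.sin_add]
  have e1 : wmean p (fun s => Real.cos (X s) * Real.cos β - Real.sin (X s) * Real.sin β)
      = wmean p (fun s => Real.cos (X s)) * Real.cos β
        - wmean p (fun s => Real.sin (X s)) * Real.sin β := by
    simp only [wmean, Finset.sum_mul, ← Finset.sum_sub_distrib]
    exact Finset.sum_congr rfl fun s _ => by ring
  have e2 : wmean p (fun s => Real.sin (X s) * Real.cos β + Real.cos (X s) * Real.sin β)
      = wmean p (fun s => Real.sin (X s)) * Real.cos β
        + wmean p (fun s => Real.cos (X s)) * Real.sin β := by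
    simp only [wmean, Finset.sum_mul, ← Finset.sum_add_distrib]
    exact Finset.sum_congr rfl fun s _ => by ring
  rw [e1, e2]
  have := Real.sin_sq_add_cos_sq β
  generalize wmean p (fun s => Real.cos (X s)) = c
  generalize wmean p (fun s => Real.sin (X s)) = v
  linear_combination ((c - 1) ^ 2 + v ^ 2) * this

/-- The logical error agrees with its leading-order value up to `O(1/m²)`: the three terms come from
the boundary terms of the variance, the third moment and the fourth moment. -/
lemma abs_logicalError_sub_leadingError_le (hK : HasStringOrder Φ a n μ K) (hN : Odd N)
    (ha : 1 ≤ a) (han : a + n < N) (hΦ : IsSymmetricSRE ξ Φ) (hμ : μ ≠ 0) (hΔ : Even Δ)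
    (hΔ0 : 0 < Δ) (hm0 : 0 < m) (hm : m * Δ = n) (β : ℝ) :
    |logicalError Φ a β μ Δ m - leadingError β μ K Δ m|
      ≤ (8 * ((ξ + 1 : ℕ) : ℝ) ^ 2 * |β / μ| ^ 2 + 104 / 3 * ((ξ + 1 : ℕ) : ℝ) ^ 2 * |β / μ| ^ 3
        + 33408 * ((ξ + 1 : ℕ) : ℝ) ^ 3 * |β / μ| ^ 4) / (m : ℝ) ^ 2 := by
  have hmr : (0 : ℝ) < m := by exact_mod_cast hm0
  have hwd := isWeaklyDependent_stringVal hK hN ha han hΦ hΔ hΔ0 hm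
  set Y : ℕ → Conf N → ℝ := fun j s => stringVal N a Δ j s - μ with hY
  set p := basisWeight a Φ
  set γ := splitAngle β μ m with hγ
  set w : ℝ := ((ξ + 1 : ℕ) : ℝ)
  rw [logicalError_eq hN hΔ hΦ (fun j hj => by
    have : j * Δ ≤ n := hm ▸ Nat.mul_le_mul_right _ hj.le
    omega) hm0 hμ, hK.leadingError_eq hN han hΦ hμ hΔ hm0 hm]
  have hmom : ∀ r : ℕ, wmean p (fun s => (γ * partialSum Y m s) ^ r)
      = γ ^ r * wmean p fun s => partialSum Y m s ^ r := by
    intro r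
    simp only [wmean, Finset.mul_sum]
    exact Finset.sum_congr rfl fun s _ => by ring
  have hexp := abs_two_mul_sqrt_sub_le (X := fun s => γ * partialSum Y m s) hwd.nonneg hwd.total
    (by have := hmom 1
        simp only [pow_one] at this
        rw [this, hwd.wmean_partialSum le_rfl, mul_zero])
  simp only [hmom] at hexp
  have hvar := hwd.abs_variance_sub_le (fun d => K (d * Δ) - μ ^ 2) fun i j hij hj =>
    hK.wmean_centred_mul hN han hΦ hΔ hij (hm ▸ Nat.mul_le_mul_right _ hj.le)
  have h3 := hwd.abs_wmean_cube_le le_rfl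
  have h4 := hwd.wmean_pow_four_le le_rfl
  set V := wmean p fun s => partialSum Y m s ^ 2
  set T := wmean p fun s => partialSum Y m s ^ 3
  set Q := wmean p fun s => partialSum Y m s ^ 4
  set L : ℝ := m * ((K (0 * Δ) - μ ^ 2) + 2 * ∑ j ∈ Icc 1 (m - 1), (K (j * Δ) - μ ^ 2))
  have hγa : |γ| = |β / μ| / m := by
    rw [hγ, splitAngle, mul_comm, ← div_div, abs_div, abs_of_pos hmr]
  set b := |β / μ|
  have hb : 0 ≤ b := abs_nonneg _
  have hsq : γ ^ 2 = b ^ 2 / m ^ 2 := by rw [← sq_abs, hγa, div_pow]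
  have hfour : γ ^ 4 = b ^ 4 / m ^ 4 := by
    rw [show γ ^ 4 = (γ ^ 2) ^ 2 by ring, hsq]; ring
  have t1 : |γ ^ 2 * V - γ ^ 2 * L| ≤ b ^ 2 / m ^ 2 * (8 * w ^ 2) := by
    rw [← mul_sub, abs_mul, abs_of_nonneg (sq_nonneg γ), hsq, abs_sub_comm]
    gcongr
  have t2 : |γ ^ 3 * T| / 3 ≤ b ^ 3 / m ^ 3 * (104 * w ^ 2 * m) / 3 := by
    rw [abs_mul, abs_pow, hγa, div_pow]
    gcongr
  have t3 : 12 * (γ ^ 4 * Q) ≤ 12 * (b ^ 4 / m ^ 4 * (2784 * w ^ 3 * m ^ 2)) := by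
    rw [hfour]
    gcongr
  refine (abs_sub_le _ (γ ^ 2 * V) _).trans ((add_le_add (hexp.trans (add_le_add t2 t3)) t1).trans
    (le_of_eq ?_))
  field_simp
  ring

end Strings

/-! ### Optimal packing: the trapezoidal rule for a convex function -/

/-- For a convex sequence, the average of two end points dominates that of two inner points placed
symmetrically. -/
lemma add_le_add_of_convex {h : ℕ} {F : ℕ → ℝ}
    (hF : ∀ i, i + 2 ≤ h → 2 * F (i + 1) ≤ F i + F (i + 2)) {c q r : ℕ} (hr : r ≤ q)
    (hcq : c + q ≤ h) : F (c + r) + F (c + (q - r)) ≤ F c + F (c + q) := by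
  have hmono : ∀ d i, i + d + 1 ≤ h → F (i + 1) - F i ≤ F (i + d + 1) - F (i + d) := by
    intro d
    induction d with
    | zero => intro i _; exact le_rfl
    | succ d ih =>
      intro i hi
      have h1 := ih i (by omega)
      have h2 := hF (i + d) (by omega)
      have e1 : i + (d + 1) + 1 = i + d + 2 := by ring
      have e2 : i + (d + 1) = i + d + 1 := by ring
      rw [e1, e2]
      linarith
  have hshift : ∀ r x y, x ≤ y → y + r ≤ h → F (x + r) - F x ≤ F (y + r) - F y := by
    intro r
    induction r with
    | zero => intro x y _ _; simp
    | succ r ih =>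
      intro x y hxy hy
      have h1 := ih x y hxy (by omega)
      obtain ⟨d, rfl⟩ := Nat.exists_eq_add_of_le hxy
      have h2 := hmono d (x + r) (by omega)
      have e : x + r + d = x + d + r := by ring
      rw [e] at h2
      rw [← add_assoc, ← add_assoc]
      linarith
  have h1 := hshift r c (c + (q - r)) (by omega) (by omega)
  have e : c + (q - r) + r = c + q := by omega
  rw [e] at h1
  linarith

/-- For a convex sequence, refining the grid of the trapezoidal rule decreases its value. -/
lemma trapezoid_le_of_convex {m q : ℕ} {F : ℕ → ℝ}
    (hF : ∀ i, i + 2 ≤ m * q → 2 * F (i + 1) ≤ F i + F (i + 2)) :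
    ∑ i ∈ range (m * q), (F i + F (i + 1))
      ≤ q * ∑ j ∈ range m, (F (j * q) + F ((j + 1) * q)) := by
  induction m with
  | zero => simp
  | succ m ih =>
    have e : (m + 1) * q = m * q + q := by ring
    rw [e] at hF
    have h1 := ih fun i hi => hF i (by omega)
    have h2 : ∑ r ∈ range q, (F (m * q + r) + F (m * q + r + 1))
        ≤ q * (F (m * q) + F (m * q + q)) := by
      have hrefl : ∑ r ∈ range q, F (m * q + r + 1) = ∑ r ∈ range q, F (m * q + (q - r)) := by
        rw [← Finset.sum_range_reflect]
        refine Finset.sum_congr rfl fun r hr => ?_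
        have := Finset.mem_range.mp hr
        congr 1
        omega
      rw [Finset.sum_add_distrib, hrefl, ← Finset.sum_add_distrib]
      refine (Finset.sum_le_card_nsmul _ _ _ fun r hr =>
        add_le_add_of_convex hF (Finset.mem_range.mp hr).le le_rfl).trans_eq ?_
      rw [Finset.card_range, nsmul_eq_mul]
    rw [e, Finset.sum_range_add, Finset.sum_range_succ, mul_add, e]
    exact add_le_add h1 h2

lemma sum_range_add_succ (F : ℕ → ℝ) {m : ℕ} (hm : 0 < m) :
    ∑ i ∈ range m, (F i + F (i + 1)) = F 0 + F m + 2 * ∑ i ∈ Icc 1 (m - 1), F i := by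
  obtain ⟨m, rfl⟩ := Nat.exists_eq_succ_of_ne_zero hm.ne'
  induction m with
  | zero => simp
  | succ m ih =>
    rw [Finset.sum_range_succ, ih (Nat.succ_pos m)]
    simp only [Nat.succ_eq_add_one, Nat.add_sub_cancel]
    rw [Finset.sum_Icc_succ_top (by omega)]
    ring

/-- The leading-order error is, up to a common factor, a trapezoidal sum of `corrF` with step `Δ`,
since `corrF` is `1` at distance `0` and vanishes at distance `n`. -/
lemma leadingError_two_le {N ξ a n m Δ : ℕ} {Φ : Conf N → ℂ} {μ : ℝ} {K : ℕ → ℝ}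
    (hK : HasStringOrder Φ a n μ K) (hconv : ConvexUpTo n K) (hN : Odd N) (ha : 1 ≤ a)
    (han : a + n < N) (hΦ : IsSymmetricSRE ξ Φ) (hn : Even n) (hξ : 2 * ξ < n) (hμ : μ ≠ 0)
    (hΔ : Even Δ) (hΔ0 : 0 < Δ) (hm0 : 0 < m) (hm : m * Δ = n) (β : ℝ) :
    leadingError β μ K 2 (n / 2) ≤ leadingError β μ K Δ m := by
  by_cases h1 : μ ^ 2 = 1
  · simp [leadingError, kappa, h1]
  have hμ1 : μ ^ 2 < 1 := by
    refine lt_of_le_of_ne ?_ h1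
    rw [← sq_abs]
    have := hK.abs_le_one hN han hΦ
    nlinarith [abs_nonneg μ]
  obtain ⟨q, rfl⟩ := hΔ
  have hq0 : 0 < q := by omega
  have hn2 : n / 2 = m * q := by
    rw [← hm, ← two_mul, mul_left_comm, Nat.mul_div_cancel_left _ two_pos]
  have hmq : 2 * (m * q) = n := by rw [← hm]; ring
  set F : ℕ → ℝ := fun i => corrF μ K (i * 2) with hFdef
  have hpos : 0 < 1 - μ ^ 2 := by linarith
  have hF : ∀ i, i + 2 ≤ m * q → 2 * F (i + 1) ≤ F i + F (i + 2) := by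
    intro i hi
    have := hconv (i * 2) (by simp) (by omega)
    simp only [hFdef, corrF]
    rw [← add_div, mul_div_assoc']
    refine div_le_div_of_nonneg_right ?_ hpos.le
    have e1 : (i + 1) * 2 = i * 2 + 2 := by ring
    have e2 : (i + 2) * 2 = i * 2 + 4 := by ring
    rw [e1, e2]
    linarith
  have hF0 : F 0 = 1 := by
    simp only [hFdef, corrF, zero_mul, hK.apply_zero hN han hΦ]
    exact div_self hpos.ne'
  have hFn : F (m * q) = 0 := by
    simp only [hFdef, corrF]
    rw [mul_comm (m * q), hmq, hK.apply_length hN ha han hΦ hn hξ, sub_self, zero_div]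
  have htrap := trapezoid_le_of_convex hF
  rw [sum_range_add_succ F (Nat.mul_pos hm0 hq0),
    sum_range_add_succ (fun j => F (j * q)) hm0, zero_mul, hF0, hFn, add_zero] at htrap
  have hmr : (0 : ℝ) < m := by exact_mod_cast hm0
  have hqr : (0 : ℝ) < q := by exact_mod_cast hq0
  have hfac : 0 ≤ β ^ 2 * (1 / μ ^ 2 - 1) := by
    refine mul_nonneg (sq_nonneg β) (sub_nonneg.mpr ?_)
    rw [le_div_iff₀ (by positivity)]
    linarith
  have e1 : leadingError β μ K 2 (n / 2)
      = β ^ 2 * (1 / μ ^ 2 - 1) * ((1 + 2 * ∑ i ∈ Icc 1 (m * q - 1), F i) / (m * q)) := by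
    rw [hn2, leadingError, kappa]
    push_cast
    ring
  have e2 : leadingError β μ K (q + q) m = β ^ 2 * (1 / μ ^ 2 - 1) *
      ((q * (1 + 2 * ∑ j ∈ Icc 1 (m - 1), F (j * q))) / (m * q)) := by
    rw [mul_comm (q : ℝ), mul_div_mul_right _ _ hqr.ne', leadingError, kappa]
    have : ∀ j, F (j * q) = corrF μ K (j * (q + q)) := fun j => by
      simp only [hFdef]; congr 1; ring
    simp only [this]
    ring
  rw [e1, e2]
  gcongr

/-! ### Logical observables and their rotations -/

/-- The Pauli matrix `Y`. -/
noncomputable def pauliY : Matrix (Fin 2) (Fin 2) ℂ := !![0, -Complex.I; Complex.I, 0]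

/-- The observable that is read out at the last site. -/
noncomputable def readoutPauli (P : Fin 3) : Matrix (Fin 2) (Fin 2) ℂ :=
  match P with
  | 0 => pauliX
  | 1 => pauliY
  | 2 => pauliZ

open Classical in
/-- The observable whose value is the computational output when all angles vanish: `X` on all sites
that contribute to the output, and the readout observable at the last site. -/
noncomputable def logicalPauli (N : ℕ) (P : Fin 3) : Op N :=
  tensorOp N fun i =>
    if i = N then readoutPauli P else if contributes N P i then pauliX else 1

/-- `Z_b` times the operators `X_{b-1} X_{b-3} …`, which measure the adaptation of the sign of the
angle at the site `b`. -/
noncomputable def dressedZ (N b : ℕ) : Op N :=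
  tensorOp N fun i => if i = b then pauliZ else if i < b ∧ Odd (b - i) then pauliX else 1

/-- The unitary `exp(i (γ/2) Z_b X_{b-1} X_{b-3} …)`. On vectors that are `X`-eigenstates on the sites
before `b`, it turns the measurement basis of the site `b` at angle `0` into the adaptive one at
angle `γ`. -/
noncomputable def siteRotation (N b : ℕ) (γ : ℝ) : Op N :=
  (Real.cos (γ / 2) : ℂ) • 1 + (Complex.I * (Real.sin (γ / 2) : ℂ)) • dressedZ N b

lemma pauliX_conjTranspose : pauliXᴴ = pauliX := by
  ext i j; fin_cases i <;> fin_cases j <;> simp [pauliX]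

lemma pauliZ_conjTranspose : pauliZᴴ = pauliZ := by
  ext i j; fin_cases i <;> fin_cases j <;> simp [pauliZ]

lemma pauliX_mul_pauliZ : pauliX * pauliZ = (-1 : ℂ) • (pauliZ * pauliX) := by
  ext i j; fin_cases i <;> fin_cases j <;> simp [pauliX, pauliZ]

lemma dressedZ_mul_self (N b : ℕ) : dressedZ N b * dressedZ N b = 1 := by
  rw [dressedZ, tensorOp_eq_siteTensor, siteTensor_mul, ← siteTensor_one]
  congr 1; funext i
  split_ifs <;> simp [pauliX_mul_self, pauliZ_mul_self]

lemma dressedZ_conjTranspose (N b : ℕ) : (dressedZ N b)ᴴ = dressedZ N b := by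
  rw [dressedZ, tensorOp_eq_siteTensor, siteTensor_conjTranspose]
  congr 1; funext i
  split_ifs <;> simp [pauliX_conjTranspose, pauliZ_conjTranspose]

lemma siteRotation_zero (N b : ℕ) : siteRotation N b 0 = 1 := by simp [siteRotation]

lemma siteRotation_conjTranspose (N b : ℕ) (γ : ℝ) :
    (siteRotation N b γ)ᴴ = siteRotation N b (-γ) := by
  rw [siteRotation, siteRotation, conjTranspose_add, conjTranspose_smul, conjTranspose_smul,
    conjTranspose_one, dressedZ_conjTranspose, neg_div, Real.cos_neg, Real.sin_neg]
  simp only [star_mul', RCLike.star_def, Complex.conj_I, Complex.conj_ofReal, Complex.ofReal_neg,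
    neg_mul, mul_neg]

lemma siteRotation_mul (N b : ℕ) (γ δ : ℝ) :
    siteRotation N b γ * siteRotation N b δ = siteRotation N b (γ + δ) := by
  have h := dressedZ_mul_self N b
  simp only [siteRotation, add_div, Real.cos_add, Real.sin_add]
  push_cast
  simp only [add_mul, mul_add, smul_mul_smul, h, one_mul, mul_one]
  have hI : Complex.I * Complex.sin (γ / 2) * (Complex.I * Complex.sin (δ / 2))
      = -(Complex.sin (γ / 2) * Complex.sin (δ / 2)) := by
    linear_combination (Complex.sin (γ / 2) * Complex.sin (δ / 2)) * Complex.I_mul_I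
  rw [hI]
  module

open Classical in
/-- `dressedZ N b` anticommutes with the logical observables to which the site `b` contributes, and
commutes with the others. -/
lemma logicalPauli_mul_dressedZ {N b : ℕ} (P : Fin 3) (hb1 : 1 ≤ b) (hb : b < N) :
    logicalPauli N P * dressedZ N b
      = (if contributes N P b then (-1 : ℂ) else 1) • (dressedZ N b * logicalPauli N P) := by
  obtain ⟨c, rfl⟩ := Nat.exists_eq_add_of_le' hb1
  rw [dressedZ, logicalPauli, tensorOp_eq_siteTensor, tensorOp_eq_siteTensor, siteTensor_mul,
    siteTensor_mul]
  refine siteTensor_smul_site _ _ _ ⟨c, by omega⟩ ?_ fun i hi => ?_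
  · have h1 : c + 1 ≠ N := hb.ne
    simp only [lab, h1, if_false, if_true]
    by_cases hc : contributes N P (c + 1)
    · simp only [hc, if_true]
      exact pauliX_mul_pauliZ
    · simp [hc]
  · have h1 : lab i ≠ c + 1 := fun h => hi (Fin.ext (by simpa [lab] using h))
    simp only [h1, if_false]
    split_ifs <;> first | (exfalso; omega) | simp

open Classical in
lemma logicalPauli_mul_siteRotation {N b : ℕ} (P : Fin 3) (hb1 : 1 ≤ b) (hb : b < N) (γ : ℝ) :
    logicalPauli N P * siteRotation N b γ
      = siteRotation N b (if contributes N P b then -γ else γ) * logicalPauli N P := by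
  have h := logicalPauli_mul_dressedZ P hb1 hb
  simp only [siteRotation, mul_add, add_mul, mul_smul_comm, smul_mul_assoc, mul_one, one_mul, h]
  split_ifs
  · rw [neg_div, Real.cos_neg, Real.sin_neg]
    push_cast
    module
  · simp

lemma contributes_of_lt {N b : ℕ} (P : Fin 3) (hb : b < N) :
    contributes N P b ↔ (P = 1 ∨ (P = 0 ∧ Odd b) ∨ (P = 2 ∧ Even b)) := by
  simp [contributes, hb.ne]

lemma dressedZ_eq {N b : ℕ} (hN : Odd N) (hb : b < N) :
    dressedZ N b = stringGE N b * logicalPauli N (if Odd b then 2 else 0) := by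
  classical
  rw [dressedZ, stringGE, logicalPauli, tensorOp_eq_siteTensor, tensorOp_eq_siteTensor,
    tensorOp_eq_siteTensor, siteTensor_mul]
  congr 1; funext i
  have hi : lab i ≤ N := by simp only [lab]; omega
  generalize lab i = j at *
  have h2 : contributes N 2 j ↔ j = N ∨ j % 2 = 0 := by simp [contributes, Nat.even_iff]
  have h0 : contributes N 0 j ↔ j = N ∨ j % 2 = 1 := by simp [contributes, Nat.odd_iff]
  by_cases ho : Odd b <;> simp only [ho, if_true, if_false, readoutPauli, h0, h2] <;>
    simp only [Nat.odd_iff] at * <;>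
    split_ifs <;> first
      | (exfalso; omega)
      | simp [pauliX_mul_self, pauliZ_mul_self]

/-- Products of logical Pauli operators follow from the products at the last site, if the
contributing sites add up modulo two. -/
lemma logicalPauli_mul_of_readoutPauli_mul {N : ℕ} (hN : 0 < N) (P Q R : Fin 3) (c : ℂ)
    (hc : readoutPauli P * readoutPauli Q = c • readoutPauli R)
    (h : ∀ i, i ≠ N → (contributes N R i ↔ ¬ (contributes N P i ↔ contributes N Q i))) :
    logicalPauli N P * logicalPauli N Q = c • logicalPauli N R := by
  classical
  rw [logicalPauli, logicalPauli, logicalPauli, tensorOp_eq_siteTensor, tensorOp_eq_siteTensor,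
    tensorOp_eq_siteTensor, siteTensor_mul]
  refine siteTensor_smul_site _ _ _ ⟨N - 1, by omega⟩ ?_ fun i hi => ?_
  · have h1 : N - 1 + 1 = N := by omega
    simp only [lab, h1, if_true, hc]
  · have h1 : lab i ≠ N := fun h => hi (Fin.ext (Nat.eq_sub_of_add_eq h))
    simp only [h1, if_false, h _ h1]
    by_cases hP : contributes N P (lab i) <;> by_cases hQ : contributes N Q (lab i) <;>
      simp [hP, hQ, pauliX_mul_self]

lemma logicalPauli_two_mul_zero {N : ℕ} (hN : 0 < N) :
    logicalPauli N 2 * logicalPauli N 0 = Complex.I • logicalPauli N 1 := by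
  refine logicalPauli_mul_of_readoutPauli_mul hN 2 0 1 _ ?_ fun i hi => ?_
  · ext i j; fin_cases i <;> fin_cases j <;> simp [readoutPauli, pauliX, pauliY, pauliZ]
  · simp [contributes, hi, ← Nat.not_even_iff_odd]

lemma logicalPauli_zero_mul_two {N : ℕ} (hN : 0 < N) :
    logicalPauli N 0 * logicalPauli N 2 = (-Complex.I) • logicalPauli N 1 := by
  refine logicalPauli_mul_of_readoutPauli_mul hN 0 2 1 _ ?_ fun i hi => ?_
  · ext i j; fin_cases i <;> fin_cases j <;> simp [readoutPauli, pauliX, pauliY, pauliZ]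
  · simp [contributes, hi, ← Nat.not_even_iff_odd]

lemma logicalPauli_two_mul_one {N : ℕ} (hN : 0 < N) :
    logicalPauli N 2 * logicalPauli N 1 = (-Complex.I) • logicalPauli N 0 := by
  refine logicalPauli_mul_of_readoutPauli_mul hN 2 1 0 _ ?_ fun i hi => ?_
  · ext i j; fin_cases i <;> fin_cases j <;> simp [readoutPauli, pauliX, pauliY, pauliZ]
  · simp [contributes, hi, ← Nat.not_even_iff_odd]

lemma logicalPauli_zero_mul_one {N : ℕ} (hN : 0 < N) :
    logicalPauli N 0 * logicalPauli N 1 = Complex.I • logicalPauli N 2 := by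
  refine logicalPauli_mul_of_readoutPauli_mul hN 0 1 2 _ ?_ fun i hi => ?_
  · ext i j; fin_cases i <;> fin_cases j <;> simp [readoutPauli, pauliX, pauliY, pauliZ]
  · simp [contributes, hi, ← Nat.not_even_iff_odd]

lemma siteRotation_two_mul (N b : ℕ) (γ : ℝ) :
    siteRotation N b (γ + γ)
      = (Real.cos γ : ℂ) • 1 + (Complex.I * (Real.sin γ : ℂ)) • dressedZ N b := by
  rw [siteRotation, add_self_div_two]

/-- A measurement at angle `γ` rotates the logical observables, with the string operator in the
place of the sign of the angle. -/
lemma siteRotation_conj_logicalPauli {N a b : ℕ} (P : Fin 3) (hN : Odd N) (hb1 : 1 ≤ b)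
    (hb : b < N) (hab : Odd a ↔ Odd b) (γ : ℝ) :
    siteRotation N b γ * logicalPauli N P * (siteRotation N b γ)ᴴ
      = ∑ Q, rotMatrix a ((Real.cos γ : ℂ) • (1 : Op N)) ((Real.sin γ : ℂ) • stringGE N b) P Q *
        logicalPauli N Q := by
  classical
  have hN0 : 0 < N := by omega
  have hI : ∀ z : ℂ, Complex.I * z * Complex.I = -z := fun z => by
    linear_combination z * Complex.I_mul_I
  rw [siteRotation_conjTranspose, mul_assoc, logicalPauli_mul_siteRotation P hb1 hb,
    ← mul_assoc, siteRotation_mul, Fin.sum_univ_three]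
  by_cases ho : Odd b
  · have hd : dressedZ N b = stringGE N b * logicalPauli N 2 := by
      rw [dressedZ_eq hN hb, if_pos ho]
    simp only [rotMatrix, hab, ho, if_true]
    fin_cases P
    · have hc : contributes N 0 b := (contributes_of_lt 0 hb).mpr (by simp [ho])
      simp [hc, siteRotation_two_mul, add_mul, hd, mul_assoc, logicalPauli_two_mul_zero hN0,
        smul_smul, hI, -Complex.ofReal_cos, -Complex.ofReal_sin]
    · have hc : contributes N 1 b := (contributes_of_lt 1 hb).mpr (by simp)
      simp [hc, siteRotation_two_mul, add_mul, hd, mul_assoc, logicalPauli_two_mul_one hN0,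
        smul_smul, hI, -Complex.ofReal_cos, -Complex.ofReal_sin]
      exact add_comm _ _
    · have hc : ¬ contributes N 2 b := by
        rw [contributes_of_lt 2 hb]; simp [ho]
      simp [hc, siteRotation_zero]
  · have hd : dressedZ N b = stringGE N b * logicalPauli N 0 := by
      rw [dressedZ_eq hN hb, if_neg ho]
    have he : Even b := Nat.not_odd_iff_even.mp ho
    simp only [rotMatrix, hab, ho, if_false]
    fin_cases P
    · have hc : ¬ contributes N 0 b := by
        rw [contributes_of_lt 0 hb]; simp [he]
      simp [hc, siteRotation_zero]
    · have hc : contributes N 1 b := (contributes_of_lt 1 hb).mpr (by simp)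
      simp [hc, siteRotation_two_mul, add_mul, hd, mul_assoc, logicalPauli_zero_mul_one hN0,
        smul_smul, hI, -Complex.ofReal_cos, -Complex.ofReal_sin]
    · have hc : contributes N 2 b := (contributes_of_lt 2 hb).mpr (by simp [he])
      simp [hc, siteRotation_two_mul, add_mul, hd, mul_assoc, logicalPauli_zero_mul_two hN0,
        smul_smul, hI, -Complex.ofReal_cos, -Complex.ofReal_sin]
      exact add_comm _ _

/-- The strings to the right of a site commute with the rotations on its left. -/
lemma stringGE_mul_siteRotation {N b i : ℕ} (hi : i < b) (hb : b < N) (γ : ℝ) :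
    stringGE N b * siteRotation N i γ = siteRotation N i γ * stringGE N b := by
  have h : stringGE N b * dressedZ N i = dressedZ N i * stringGE N b := by
    rw [dressedZ, stringGE, tensorOp_eq_siteTensor, tensorOp_eq_siteTensor, siteTensor_mul,
      siteTensor_mul]
    congr 1; funext j
    split_ifs <;> first | (exfalso; omega) | simp
  simp only [siteRotation, mul_add, add_mul, mul_smul_comm, smul_mul_assoc, mul_one, one_mul, h]

/-! ### The measured observable -/

/-- The observable whose expectation value is the component `P` of the Bloch vector. -/
noncomputable def recordObs {N : ℕ} (θ : ℕ → ℝ) (P : Fin 3) : Op N :=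
  ∑ s : Conf N, ((-1 : ℂ) ^ outputBit P s) •
    vecMulVec (recordVec θ P s) (star (recordVec θ P s))

lemma bloch_eq_expval {N : ℕ} (Φ : Conf N → ℂ) (θ : ℕ → ℝ) (P : Fin 3) :
    bloch Φ θ P = expval Φ (recordObs θ P) := by
  rw [expval_eq_re, recordObs, cexpval_sum, Complex.re_sum, bloch]
  refine Finset.sum_congr rfl fun s _ => ?_
  have h : cexpval Φ (vecMulVec (recordVec θ P s) (star (recordVec θ P s)))
      = ((recordProb Φ θ P s : ℝ) : ℂ) := by
    rw [cexpval, recordProb]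
    have h1 : vecMulVec (recordVec θ P s) (star (recordVec θ P s)) *ᵥ Φ
        = (star (recordVec θ P s) ⬝ᵥ Φ) • recordVec θ P s := by
      ext t
      simp [vecMulVec_mulVec, mul_comm]
    rw [h1, dotProduct_smul, smul_eq_mul, Complex.ofReal_pow, ← Complex.conj_mul', mul_comm]
    congr 1
    rw [← star_star (recordVec θ P s), star_dotProduct_star, star_star]
    simp [dotProduct_comm]
  rw [cexpval_smul, h]
  have : ((-1 : ℂ) ^ outputBit P s) = (((-1 : ℝ) ^ outputBit P s : ℝ) : ℂ) := by push_cast; rfl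
  rw [this, ← Complex.ofReal_mul, Complex.ofReal_re]

lemma measVec_zero (q s : ℕ) : measVec 0 q s = measVec 0 0 s := by simp [measVec]

/-- A rotated measurement vector is the unrotated one, rotated about the `z`-axis. -/
lemma measVec_eq (γ : ℝ) (q s : ℕ) (u : Fin 2) :
    measVec γ q s u = Complex.exp (-(((-1) ^ q * (γ / 2) : ℝ) : ℂ) * Complex.I) *
      ((Real.cos (γ / 2) : ℂ) * measVec 0 q s u
        + Complex.I * (Real.sin (γ / 2) : ℂ) * ((-1) ^ q * (pauliZ *ᵥ measVec 0 q s) u)) := by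
  obtain ⟨x, rfl⟩ : ∃ x, γ = 2 * x := ⟨γ / 2, by ring⟩
  rw [mul_div_cancel_left₀ x two_ne_zero]
  have hp : ((-1 : ℂ)) ^ q = (((-1 : ℝ) ^ q : ℝ) : ℂ) := by push_cast; rfl
  rw [hp]
  have hε := neg_one_pow_eq_or ℝ q
  simp only [measVec]
  generalize (-1 : ℝ) ^ q = ε at *
  have h1 : (Real.cos x : ℂ) + Complex.I * Real.sin x * ε
      = Complex.exp (((ε * x : ℝ) : ℂ) * Complex.I) := by
    rw [Complex.exp_mul_I]
    rcases hε with rfl | rfl <;> push_cast <;> simp <;> ring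
  have h2 : (Real.cos x : ℂ) - Complex.I * Real.sin x * ε
      = Complex.exp (-((ε * x : ℝ) : ℂ) * Complex.I) := by
    rw [Complex.exp_mul_I]
    rcases hε with rfl | rfl <;> push_cast <;> simp <;> ring
  have h3 : Complex.exp (-((ε * x : ℝ) : ℂ) * Complex.I) *
      Complex.exp (((ε * x : ℝ) : ℂ) * Complex.I) = 1 := by
    rw [← Complex.exp_add, neg_mul, neg_add_cancel, Complex.exp_zero]
  have h4 : Complex.exp (-((ε * (2 * x) : ℝ) : ℂ) * Complex.I)
      = Complex.exp (-((ε * x : ℝ) : ℂ) * Complex.I) *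
        Complex.exp (-((ε * x : ℝ) : ℂ) * Complex.I) := by
    rw [← Complex.exp_add]
    congr 1
    push_cast
    ring
  rw [h4]
  rw [← h1] at h3
  simp only [Complex.ofReal_mul, neg_mul] at h2 h3 h4
  fin_cases u
  · simp [pauliZ, Matrix.mulVec, dotProduct, Fin.sum_univ_two, -Complex.ofReal_cos,
      -Complex.ofReal_sin]
    linear_combination (-((Real.sqrt 2 : ℂ))⁻¹) * h3
  · simp [pauliZ, Matrix.mulVec, dotProduct, Fin.sum_univ_two, -Complex.ofReal_cos,
      -Complex.ofReal_sin]
    rw [← h2]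
    ring

lemma pauliX_mulVec_measVec (q s : ℕ) :
    pauliX *ᵥ measVec 0 q s = ((-1 : ℂ) ^ s) • measVec 0 q s := by
  have hs : ((-1 : ℂ) ^ s) * (-1) ^ s = 1 := by rw [← mul_pow]; simp
  ext u
  fin_cases u <;> simp [pauliX, measVec, Matrix.mulVec, dotProduct, Fin.sum_univ_two]
  · ring
  · linear_combination (-((Real.sqrt 2 : ℂ))⁻¹) * hs

/-- The measurement vector at a single site, given the outcomes `s`. -/
noncomputable def siteVec {N : ℕ} (θ : ℕ → ℝ) (P : Fin 3) (s : Conf N) (i : Fin N) : Fin 2 → ℂ :=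
  fun u => if lab i = N then readoutVec P (s i) u else measVec (θ (lab i)) (flips s i) (s i : ℕ) u

lemma recordVec_eq {N : ℕ} (θ : ℕ → ℝ) (P : Fin 3) (s : Conf N) :
    recordVec θ P s = fun t => ∏ i, siteVec θ P s i (t i) := rfl

/-- If the sites before `b` are measured at angle `0`, a non-zero angle at `b` amounts, up to a
phase, to the unitary `siteRotation N b`. -/
lemma recordVec_eq_smul {N : ℕ} (θ θ' : ℕ → ℝ) (P : Fin 3) (s : Conf N) (b : Fin N)
    (hb : lab b < N) (h0 : ∀ i, 1 ≤ i → i ≤ lab b → θ' i = 0)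
    (hθ : ∀ i, 1 ≤ i → i ≠ lab b → θ i = θ' i) :
    recordVec θ P s = Complex.exp
        (-(((-1) ^ flips s b * (θ (lab b) / 2) : ℝ) : ℂ) * Complex.I) •
      (siteRotation N (lab b) (θ (lab b)) *ᵥ recordVec θ' P s) := by
  have hlab : ∀ i : Fin N, 1 ≤ lab i := fun i => by simp [lab]
  have hne : lab b ≠ N := hb.ne
  have hdressed : dressedZ N (lab b) *ᵥ recordVec θ' P s = fun t => (-1 : ℂ) ^ flips s b *
      ((pauliZ *ᵥ siteVec θ' P s b) (t b) * ∏ i ∈ univ.erase b, siteVec θ' P s i (t i)) := by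
    rw [recordVec_eq, dressedZ, tensorOp_eq_siteTensor, siteTensor_mulVec]
    funext t
    have hfl : (-1 : ℂ) ^ flips s b
        = ∏ i : Fin N, (-1 : ℂ) ^ (if i < b ∧ Odd (lab b - lab i) then (s i : ℕ) else 0) := by
      rw [Finset.prod_pow_eq_pow_sum]; rfl
    rw [hfl, ← Finset.mul_prod_erase univ _ (Finset.mem_univ b),
      ← Finset.mul_prod_erase univ (fun i : Fin N => (-1 : ℂ) ^
        (if i < b ∧ Odd (lab b - lab i) then (s i : ℕ) else 0)) (Finset.mem_univ b)]
    simp only [if_true, lt_irrefl, false_and, if_false, pow_zero, one_mul]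
    rw [mul_left_comm, ← Finset.prod_mul_distrib]
    congr 1
    refine Finset.prod_congr rfl fun i hi => ?_
    have hib : lab i ≠ lab b := fun h =>
      Finset.ne_of_mem_erase hi (Fin.ext (by simpa [lab] using h))
    have hlt : lab i < lab b ↔ i < b := by simp only [lab, Fin.lt_def]; omega
    simp only [hib, if_false, hlt]
    split_ifs with h
    · have hiN : lab i ≠ N := by have := hlt.mpr h.1; omega
      have e : siteVec θ' P s i = measVec 0 (flips s i) (s i : ℕ) := by
        funext u
        rw [siteVec, if_neg hiN, h0 (lab i) (hlab i) (hlt.mpr h.1).le]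
      rw [e, pauliX_mulVec_measVec]
      rfl
    · simp
  have hb' : siteVec θ' P s b = measVec 0 (flips s b) (s b : ℕ) := by
    funext u
    rw [siteVec, if_neg hne, h0 (lab b) (hlab b) le_rfl]
  have hbθ : ∀ u, siteVec θ P s b u = measVec (θ (lab b)) (flips s b) (s b : ℕ) u := by
    intro u
    rw [siteVec, if_neg hne]
  rw [siteRotation, add_mulVec, smul_mulVec, smul_mulVec, one_mulVec, hdressed]
  funext t
  simp only [recordVec_eq, Pi.smul_apply, Pi.add_apply, smul_eq_mul]
  rw [← Finset.mul_prod_erase univ _ (Finset.mem_univ b),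
    ← Finset.mul_prod_erase univ (fun i => siteVec θ' P s i (t i)) (Finset.mem_univ b), hbθ,
    measVec_eq, ← hb']
  have hrest : ∏ i ∈ univ.erase b, siteVec θ P s i (t i)
      = ∏ i ∈ univ.erase b, siteVec θ' P s i (t i) := by
    refine Finset.prod_congr rfl fun i hi => ?_
    have hib : lab i ≠ lab b := fun h =>
      Finset.ne_of_mem_erase hi (Fin.ext (by simpa [lab] using h))
    rw [siteVec, siteVec, hθ (lab i) (hlab i) hib]
  rw [hrest]
  ring

/-- Switching on the angle at the first site whose angle does not vanish. -/
lemma recordObs_eq_conj {N : ℕ} (θ θ' : ℕ → ℝ) (P : Fin 3) (b : Fin N)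
    (hb : lab b < N) (h0 : ∀ i, 1 ≤ i → i ≤ lab b → θ' i = 0)
    (hθ : ∀ i, 1 ≤ i → i ≠ lab b → θ i = θ' i) :
    (recordObs θ P : Op N) = siteRotation N (lab b) (θ (lab b)) * recordObs θ' P *
      (siteRotation N (lab b) (θ (lab b)))ᴴ := by
  rw [recordObs, recordObs, Finset.mul_sum, Finset.sum_mul]
  refine Finset.sum_congr rfl fun s _ => ?_
  rw [mul_smul_comm, smul_mul_assoc, mul_vecMulVec, vecMulVec_mul, ← star_mulVec,
    recordVec_eq_smul θ θ' P s b hb h0 hθ, star_smul, smul_vecMulVec, vecMulVec_smul, smul_smul]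
  have : Complex.exp (-(((-1) ^ flips s b * (θ (lab b) / 2) : ℝ) : ℂ) * Complex.I) *
      star (Complex.exp (-(((-1) ^ flips s b * (θ (lab b) / 2) : ℝ) : ℂ) * Complex.I)) = 1 := by
    rw [RCLike.star_def, ← Complex.exp_conj, ← Complex.exp_add, map_mul, map_neg,
      Complex.conj_ofReal, Complex.conj_I, ← Complex.exp_zero]
    congr 1
    ring
  rw [smul_smul, mul_assoc, this, mul_one]

/-- Without rotations, the measured observables are the logical Pauli operators. -/
lemma recordObs_eq_logicalPauli {N : ℕ} (θ : ℕ → ℝ) (P : Fin 3)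
    (h0 : ∀ i, 1 ≤ i → i < N → θ i = 0) : (recordObs θ P : Op N) = logicalPauli N P := by
  classical
  have hsite : ∀ (s t t' : Conf N), ((-1 : ℂ) ^ outputBit P s •
      vecMulVec (recordVec θ P s) (star (recordVec θ P s))) t t'
      = ∏ i, ((-1 : ℂ) ^ (if contributes N P (lab i) then (s i : ℕ) else 0) *
        ((if lab i = N then readoutVec P (s i) (t i) else measVec 0 0 (s i : ℕ) (t i)) *
        star (if lab i = N then readoutVec P (s i) (t' i) else measVec 0 0 (s i : ℕ) (t' i)))) := by
    intro s t t'
    have hv : ∀ t : Conf N, recordVec θ P s t = ∏ i : Fin N,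
        if lab i = N then readoutVec P (s i) (t i) else measVec 0 0 (s i : ℕ) (t i) := by
      intro t
      refine Finset.prod_congr rfl fun i _ => ?_
      split_ifs with h
      · rfl
      · rw [h0 (lab i) (by simp [lab]) (lt_of_le_of_ne (by simp only [lab]; omega) h), measVec_zero]
    rw [Matrix.smul_apply, vecMulVec_apply, Pi.star_apply, hv, hv, Finset.prod_mul_distrib,
      Finset.prod_mul_distrib, Finset.prod_pow_eq_pow_sum, star_prod]
    simp only [outputBit, smul_eq_mul]
  ext t t'
  rw [recordObs, Matrix.sum_apply, Finset.sum_congr rfl fun s _ => hsite s t t']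
  have := Finset.prod_univ_sum (fun _ : Fin N => (Finset.univ : Finset (Fin 2)))
    fun i u => ((-1 : ℂ) ^ (if contributes N P (lab i) then (u : ℕ) else 0) *
        ((if lab i = N then readoutVec P u (t i) else measVec 0 0 (u : ℕ) (t i)) *
        star (if lab i = N then readoutVec P u (t' i) else measVec 0 0 (u : ℕ) (t' i))))
  rw [Fintype.piFinset_univ] at this
  rw [← this, logicalPauli, tensorOp_eq_siteTensor, siteTensor_apply]
  refine Finset.prod_congr rfl fun i _ => ?_
  have hh := inv_sqrt_two_mul_self
  have hh' : ((Real.sqrt 2 : ℂ))⁻¹ * ((Real.sqrt 2 : ℂ))⁻¹ = 1 / 2 := by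
    rw [← hh]; simp
  have hI1 : ((Real.sqrt 2 : ℂ))⁻¹ * (((Real.sqrt 2 : ℂ))⁻¹ * Complex.I) = Complex.I / 2 := by
    linear_combination Complex.I * hh'
  have hI2 : ((Real.sqrt 2 : ℂ))⁻¹ * Complex.I * ((Real.sqrt 2 : ℂ))⁻¹ = Complex.I / 2 := by
    linear_combination Complex.I * hh'
  clear hsite this
  generalize t i = u
  generalize t' i = u'
  rw [Fin.sum_univ_two]
  by_cases hN : lab i = N
  · have hc : contributes N P (lab i) := Or.inl hN
    simp only [hN] at hc
    simp only [hN, hc, if_true]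
    fin_cases P <;> fin_cases u <;> fin_cases u' <;>
      simp [readoutVec, readoutPauli, pauliX, pauliY, pauliZ, hh', hI1, hI2] <;> ring
  · simp only [hN, if_false]
    by_cases hc : contributes N P (lab i) <;> fin_cases u <;> fin_cases u' <;>
      simp [hc, measVec, pauliX, hh'] <;> norm_num

/-! ### The observable measured with given angles -/

/-- The product of the rotations implemented by the sites `1, …, k`. -/
noncomputable def rotationProd (N : ℕ) (θ : ℕ → ℝ) : ℕ → Op N
  | 0 => 1
  | k + 1 => rotationProd N θ k * siteRotation N (k + 1) (θ (k + 1))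

lemma rotationProd_congr {N : ℕ} {θ θ' : ℕ → ℝ} {k : ℕ} (h : ∀ i, 1 ≤ i → i ≤ k → θ i = θ' i) :
    rotationProd N θ k = rotationProd N θ' k := by
  induction k with
  | zero => rfl
  | succ k ih =>
    rw [rotationProd, rotationProd, ih fun i h1 h2 => h i h1 (by omega),
      h (k + 1) (by omega) le_rfl]

lemma rotationProd_eq_of_zero {N : ℕ} {θ : ℕ → ℝ} {p k : ℕ} (hpk : p ≤ k)
    (h : ∀ i, p < i → θ i = 0) : rotationProd N θ k = rotationProd N θ p := by
  induction k, hpk using Nat.le_induction with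
  | base => rfl
  | succ k hk ih => rw [rotationProd, h (k + 1) (by omega), siteRotation_zero, mul_one, ih]

lemma recordObs_eq_rotationProd_conj {N : ℕ} (θ : ℕ → ℝ) (P : Fin 3) {k : ℕ} (hk : k < N) :
    (recordObs θ P : Op N) = rotationProd N θ k *
      recordObs (fun i => if i ≤ k then 0 else θ i) P * (rotationProd N θ k)ᴴ := by
  have hcongr : ∀ θ₁ θ₂ : ℕ → ℝ, (∀ i, 1 ≤ i → θ₁ i = θ₂ i) →
      (recordObs θ₁ P : Op N) = recordObs θ₂ P := by
    intro θ₁ θ₂ h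
    have : ∀ s : Conf N, recordVec θ₁ P s = recordVec θ₂ P s := fun s => by
      funext t
      refine Finset.prod_congr rfl fun i _ => ?_
      rw [h (lab i) (by simp [lab])]
    simp only [recordObs, this]
  induction k with
  | zero =>
    rw [rotationProd, one_mul, conjTranspose_one, mul_one]
    exact hcongr _ _ fun i hi => by rw [if_neg (by omega)]
  | succ k ih =>
    have h1 := recordObs_eq_conj (N := N) (fun i => if i ≤ k then 0 else θ i)
      (fun i => if i ≤ k + 1 then 0 else θ i) P ⟨k, by omega⟩ (by simp only [lab]; omega)
      (fun i _ hi => if_pos hi) (fun i _ hi => by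
        simp only [lab] at hi
        have : i ≤ k ↔ i ≤ k + 1 := by omega
        simp only [this])
    simp only [lab, show ¬ k + 1 ≤ k by omega, if_false] at h1
    rw [ih (by omega), h1, rotationProd, conjTranspose_mul]
    noncomm_ring

lemma recordObs_eq_conj_logicalPauli {N : ℕ} (hN : 0 < N) (θ : ℕ → ℝ) (P : Fin 3) :
    (recordObs θ P : Op N) = rotationProd N θ (N - 1) * logicalPauli N P *
      (rotationProd N θ (N - 1))ᴴ := by
  rw [recordObs_eq_rotationProd_conj θ P (Nat.sub_one_lt hN.ne'),
    recordObs_eq_logicalPauli (fun i => if i ≤ N - 1 then 0 else θ i) P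
      fun i _ hi => if_pos (by omega)]

lemma stringGE_mul_rotationProd {N b k : ℕ} (hk : k < b) (hb : b < N) (θ : ℕ → ℝ) :
    stringGE N b * rotationProd N θ k = rotationProd N θ k * stringGE N b := by
  induction k with
  | zero => simp [rotationProd]
  | succ k ih =>
    rw [rotationProd, ← mul_assoc, ih (by omega), mul_assoc, stringGE_mul_siteRotation hk hb,
      mul_assoc]

/-- A property of `0`, `1`, the cosine and `±` the sine holds for all entries of `rotMatrix`. -/
lemma rotMatrix_apply_induction {A : Type*} [Ring A] (p : A → Prop) (a : ℕ) {c S : A} (h0 : p 0)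
    (h1 : p 1) (hc : p c) (hS : p S) (hneg : p (-S)) (i j : Fin 3) : p (rotMatrix a c S i j) := by
  unfold rotMatrix
  split_ifs <;> fin_cases i <;> fin_cases j <;> simpa

/-- Switching on the angle at `b`, to the right of all non-zero angles. -/
lemma recordObs_update {N a b : ℕ} (hN : Odd N) (hb1 : 1 ≤ b) (hb : b < N) (hab : Odd a ↔ Odd b)
    {θ θ' : ℕ → ℝ} (γ : ℝ) (h0 : ∀ i, b ≤ i → θ i = 0) (hθ : ∀ i, i ≠ b → θ' i = θ i)
    (hγ : θ' b = γ) (P : Fin 3) :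
    (recordObs θ' P : Op N) = ∑ Q, rotMatrix a ((Real.cos γ : ℂ) • (1 : Op N))
      ((Real.sin γ : ℂ) • stringGE N b) P Q * recordObs θ Q := by
  have hN0 : 0 < N := by omega
  obtain ⟨c, rfl⟩ := Nat.exists_eq_add_of_le' hb1
  have hW : rotationProd N θ' (N - 1) = rotationProd N θ c * siteRotation N (c + 1) γ := by
    rw [rotationProd_eq_of_zero (p := c + 1) (by omega)
      fun i hi => by rw [hθ i (by omega), h0 i (by omega)], rotationProd, hγ,
      rotationProd_congr fun i _ hi => hθ i (by omega)]
  have hW' : rotationProd N θ (N - 1) = rotationProd N θ c :=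
    rotationProd_eq_of_zero (by omega) fun i hi => h0 i (by omega)
  have hcomm : ∀ Q, rotMatrix a ((Real.cos γ : ℂ) • (1 : Op N))
      ((Real.sin γ : ℂ) • stringGE N (c + 1)) P Q * rotationProd N θ c
      = rotationProd N θ c * rotMatrix a ((Real.cos γ : ℂ) • (1 : Op N))
      ((Real.sin γ : ℂ) • stringGE N (c + 1)) P Q := by
    intro Q
    have hS : ((Real.sin γ : ℂ) • stringGE N (c + 1)) * rotationProd N θ c
        = rotationProd N θ c * ((Real.sin γ : ℂ) • stringGE N (c + 1)) := by
      rw [smul_mul_assoc, mul_smul_comm, stringGE_mul_rotationProd (Nat.lt_succ_self c) hb]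
    refine rotMatrix_apply_induction
      (fun A : Op N => A * rotationProd N θ c = rotationProd N θ c * A) a ?_ ?_ ?_ hS ?_ P Q
    · simp
    · simp
    · simp
    · rw [neg_mul, mul_neg, hS]
  rw [recordObs_eq_conj_logicalPauli hN0, hW, conjTranspose_mul]
  calc _ = rotationProd N θ c * (siteRotation N (c + 1) γ * logicalPauli N P *
        (siteRotation N (c + 1) γ)ᴴ) * (rotationProd N θ c)ᴴ := by noncomm_ring
    _ = _ := by
      rw [siteRotation_conj_logicalPauli P hN hb1 hb hab, Finset.mul_sum, Finset.sum_mul]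
      refine Finset.sum_congr rfl fun Q _ => ?_
      rw [recordObs_eq_conj_logicalPauli hN0, hW', ← mul_assoc, ← hcomm Q]
      simp only [mul_assoc]

/-- The rotation operators act on the observables measured without the rotation. -/
lemma recordObs_withRotation {N a Δ m : ℕ} (hN : Odd N) (ha : 1 ≤ a) (hΔ : Even Δ) (hΔ0 : 0 < Δ)
    (hm : ∀ j, j < m → a + j * Δ < N) {θ : ℕ → ℝ} (h0 : ∀ i, a ≤ i → θ i = 0) (γ : ℝ) (P : Fin 3) :
    (recordObs (withRotation θ a Δ m γ) P : Op N)
      = ∑ Q, stepProduct N a Δ γ m P Q * recordObs θ Q := by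
  induction m generalizing P with
  | zero =>
    have : withRotation θ a Δ 0 γ = θ := by funext i; simp [withRotation]
    rw [this, stepProduct, Finset.sum_eq_single P] <;> simp +contextual [eq_comm]
  | succ m ih =>
    have hlt : ∀ j, j < m → a + j * Δ < a + m * Δ := fun j hj => by
      have := Nat.mul_lt_mul_of_pos_right hj hΔ0
      omega
    have hpar : Odd a ↔ Odd (a + m * Δ) := by
      have := hΔ.mul_left m
      simp only [Nat.odd_iff, Nat.even_iff] at *
      omega
    rw [recordObs_update (θ := withRotation θ a Δ m γ) hN (by omega) (hm m (Nat.lt_succ_self m))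
      hpar γ ?_ ?_ ?_ P]
    · rw [stepProduct]
      simp only [Matrix.mul_apply, Finset.sum_mul, ih fun j hj => hm j (by omega), Finset.mul_sum]
      rw [Finset.sum_comm]
      simp only [mul_assoc]
    · intro i hi
      rw [withRotation, if_neg, h0 i (by omega)]
      rintro ⟨j, hj, rfl⟩
      have := hlt j hj
      omega
    · intro i hi
      have : (∃ j, j < m + 1 ∧ i = a + j * Δ) ↔ ∃ j, j < m ∧ i = a + j * Δ := by
        constructor
        · rintro ⟨j, hj, rfl⟩
          refine ⟨j, lt_of_le_of_ne (by omega) ?_, rfl⟩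
          rintro rfl
          exact hi rfl
        · rintro ⟨j, hj, rfl⟩
          exact ⟨j, by omega, rfl⟩
      simp only [withRotation, this]
    · exact if_pos ⟨m, Nat.lt_succ_self m, rfl⟩

/-! ### Decoupling of the preparation from the rotation -/

lemma supportedOn_siteRotation {N b p : ℕ} (hb : b ≤ p) (γ : ℝ) :
    SupportedOn {i | lab i ≤ p} (siteRotation N b γ) := by
  refine ((supportedOn_one _).smul _).add (SupportedOn.smul _ ?_)
  refine supportedOn_siteTensor fun i hi => ?_
  simp only [Set.mem_ofPred_eq] at hi
  rw [if_neg (by omega), if_neg (by omega)]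

lemma supportedOn_rotationProd {N k p : ℕ} (hk : k ≤ p) (θ : ℕ → ℝ) :
    SupportedOn {i | lab i ≤ p} (rotationProd N θ k) := by
  induction k with
  | zero => exact supportedOn_one _
  | succ k ih => exact (ih (by omega)).mul (supportedOn_siteRotation hk _)

open Classical in
lemma logicalPauli_mul_rotationProd_conjTranspose {N : ℕ} (P : Fin 3) (θ : ℕ → ℝ) {k : ℕ}
    (hk : k < N) : logicalPauli N P * (rotationProd N θ k)ᴴ
      = (rotationProd N (fun i => if contributes N P i then -θ i else θ i) k)ᴴ *
        logicalPauli N P := by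
  induction k with
  | zero => simp [rotationProd]
  | succ k ih =>
    rw [rotationProd, rotationProd, conjTranspose_mul, conjTranspose_mul,
      siteRotation_conjTranspose, siteRotation_conjTranspose, ← mul_assoc,
      logicalPauli_mul_siteRotation P (by omega) hk, mul_assoc, ih (by omega), ← mul_assoc]
    congr 3
    split_ifs <;> rfl

/-- By the symmetry of the state, a logical observable acts like an operator on the first site. -/
lemma exists_supportedOn_logicalPauli_mulVec {N ξ p : ℕ} {Φ : Conf N → ℂ} (hN : Odd N)
    (hN1 : 1 < N) (hΦ : IsSymmetricSRE ξ Φ) (hp : 1 ≤ p) (P : Fin 3) :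
    ∃ D : Op N, SupportedOn {i | lab i ≤ p} D ∧ logicalPauli N P *ᵥ Φ = D *ᵥ Φ := by
  set Z₁ : Op N := tensorOp N fun i => if i = 1 then pauliZ else 1
  have hZ : SupportedOn {i | lab i ≤ p} Z₁ := by
    refine supportedOn_siteTensor fun i hi => if_neg ?_
    simp only [Set.mem_ofPred_eq] at hi
    omega
  have h0 : logicalPauli N 0 *ᵥ Φ = Φ := by
    have : logicalPauli N 0 = symG1 N := by
      rw [logicalPauli, symG1, tensorOp_eq_siteTensor, tensorOp_eq_siteTensor]
      congr 1; funext i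
      have : contributes N 0 (lab i) ↔ lab i = N ∨ Odd (lab i) := by simp [contributes]
      simp only [this, readoutPauli]
      simp only [Nat.odd_iff] at *
      split_ifs <;> first | rfl | (exfalso; omega)
    rw [this, hΦ.sym1]
  have h2 : logicalPauli N 2 *ᵥ Φ = Z₁ *ᵥ Φ := by
    have : logicalPauli N 2 = Z₁ * symG0 N := by
      simp only [logicalPauli, symG0, Z₁, tensorOp_eq_siteTensor, siteTensor_mul]
      congr 1; funext i
      have : contributes N 2 (lab i) ↔ lab i = N ∨ Even (lab i) := by simp [contributes]
      simp only [this, readoutPauli]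
      simp only [Nat.odd_iff, Nat.even_iff] at *
      split_ifs <;> first | (exfalso; omega) | simp [pauliZ_mul_self]
    rw [this, ← Matrix.mulVec_mulVec, hΦ.sym0]
  fin_cases P
  · exact ⟨1, supportedOn_one _, by simpa using h0⟩
  · refine ⟨(-Complex.I) • Z₁, hZ.smul _, ?_⟩
    have h1 := logicalPauli_two_mul_zero (N := N) (by omega)
    have h3 : logicalPauli N 1 = (-Complex.I) • (logicalPauli N 2 * logicalPauli N 0) := by
      rw [h1, smul_smul]; simp
    change logicalPauli N 1 *ᵥ Φ = _
    rw [h3, smul_mulVec, smul_mulVec, ← Matrix.mulVec_mulVec, h0, h2]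
  · exact ⟨Z₁, hZ, h2⟩

/-- By the symmetry of the state, the observable measured by the preparation acts like an operator
on the sites used in the preparation. -/
lemma exists_supportedOn_recordObs_mulVec {N ξ p : ℕ} {Φ : Conf N → ℂ} (hN : Odd N)
    (hpN : p < N) (hΦ : IsSymmetricSRE ξ Φ) (hp : 1 ≤ p) {θ : ℕ → ℝ} (h0 : ∀ i, p < i → θ i = 0)
    (P : Fin 3) :
    ∃ A : Op N, SupportedOn {i | lab i ≤ p} A ∧ recordObs θ P *ᵥ Φ = A *ᵥ Φ := by
  classical
  obtain ⟨D, hD, hDΦ⟩ := exists_supportedOn_logicalPauli_mulVec hN (by omega) hΦ hp P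
  refine ⟨rotationProd N θ p *
    (rotationProd N (fun i => if contributes N P i then -θ i else θ i) p)ᴴ * D,
    ((supportedOn_rotationProd le_rfl _).mul (supportedOn_rotationProd le_rfl _).conjTranspose).mul
      hD, ?_⟩
  rw [recordObs_eq_conj_logicalPauli (by omega), rotationProd_eq_of_zero (p := p) (by omega) h0,
    mul_assoc, logicalPauli_mul_rotationProd_conjTranspose P θ hpN, ← mul_assoc,
    ← Matrix.mulVec_mulVec, hDΦ, Matrix.mulVec_mulVec]

/-- Changing the angles on the symmetry-breaking sites multiplies the Bloch vector by `⟨∏ₖ M_k⟩`. -/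
lemma bloch_withRotation {N ξ a n m Δ p : ℕ} {Φ : Conf N → ℂ} (hN : Odd N) (ha : 1 ≤ a)
    (han : a + n < N) (hΦ : IsSymmetricSRE ξ Φ) (hΔ : Even Δ) (hΔ0 : 0 < Δ) (hm : m * Δ = n)
    (hp : 1 ≤ p) (hpa : p + 2 * ξ < a) {θ : ℕ → ℝ} (h0 : ∀ i, p < i → θ i = 0) (γ : ℝ) :
    bloch Φ (withRotation θ a Δ m γ) = logicalOp Φ a Δ m γ *ᵥ bloch Φ θ := by
  have hmN : ∀ j, j < m → a + j * Δ < N := fun j hj => by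
    have : j * Δ ≤ n := hm ▸ Nat.mul_le_mul_right _ hj.le
    omega
  obtain ⟨U, hU, hUΦ⟩ := hΦ.circuit
  funext P
  rw [bloch_eq_expval, expval_eq_re, recordObs_withRotation hN ha hΔ hΔ0 hmN
    (fun i hi => h0 i (by omega)), cexpval_sum, Complex.re_sum, Matrix.mulVec, dotProduct]
  refine Finset.sum_congr rfl fun Q _ => ?_
  obtain ⟨A, hA, hAΦ⟩ := exists_supportedOn_recordObs_mulVec hN (by omega) hΦ hp h0 Q
  have hdep : ∀ g : ℝ → ℝ, DependsOn
      (fun s : Conf N => g (γ * ∑ j ∈ range m, stringVal N a Δ j s)) {i | a - 1 < lab i} := by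
    intro g s t hst
    simp only
    rw [Finset.sum_congr rfl fun j hj => ?_]
    refine dependsOn_signProd _ (fun i hi => ?_) hst
    have := hmN j (Finset.mem_range.mp hj)
    simp only [Set.mem_ofPred_eq]
    simp only [stringSites] at hi
    omega
  have hsupp : SupportedOn {i | a - 1 < lab i} (stepProduct N a Δ γ m P Q) := by
    rw [stepProduct_eq hN hΔ γ hmN]
    refine rotMatrix_apply_induction (SupportedOn {i : Fin N | a - 1 < lab i}) a
      (supportedOn_zero _) (supportedOn_one _) (supportedOn_diagOp a (hdep Real.cos))
      (supportedOn_diagOp a (hdep Real.sin)) ?_ P Q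
    rw [← neg_one_smul ℂ]
    exact (supportedOn_diagOp a (hdep Real.sin)).smul _
  have hherm : (stepProduct N a Δ γ m P Q)ᴴ = stepProduct N a Δ γ m P Q := by
    rw [stepProduct_eq hN hΔ γ hmN]
    refine rotMatrix_apply_induction (fun B : Op N => Bᴴ = B) a conjTranspose_zero
      conjTranspose_one (diagOp_conjTranspose _ _) (diagOp_conjTranspose _ _) ?_ P Q
    rw [conjTranspose_neg, diagOp_conjTranspose]
  set B := stepProduct N a Δ γ m P Q with hB
  have hreal : (cexpval Φ B).im = 0 := by
    have := star_cexpval Φ B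
    rw [hherm] at this
    exact Complex.conj_eq_iff_im.mp this
  have hfac : cexpval Φ (B * A) = cexpval Φ B * cexpval Φ A := by
    have h1 := hU.cexpval_mul hA.conjTranspose hsupp (by omega)
    rw [← hUΦ] at h1
    have h2 := congrArg star h1
    rw [star_mul', star_cexpval, star_cexpval, star_cexpval, conjTranspose_mul,
      conjTranspose_conjTranspose, hherm] at h2
    rw [h2, mul_comm]
  have e1 : cexpval Φ (B * recordObs θ Q) = cexpval Φ (B * A) := by
    simp only [cexpval, ← Matrix.mulVec_mulVec, hAΦ]
  have e2 : cexpval Φ (recordObs θ Q) = cexpval Φ A := by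
    simp only [cexpval, hAΦ]
  rw [e1, hfac, Complex.mul_re, hreal, zero_mul, sub_zero, bloch_eq_expval, expval_eq_re, e2]
  rfl

end ClusterMBQC

theorem theorem2 (ξ : ℕ) (β μ : ℝ) (hμ : μ ≠ 0) :
    ∃ C : ℝ, ∀ (N : ℕ) (Φ : Conf N → ℂ) (a n : ℕ) (K : ℕ → ℝ),
      Odd N → 1 ≤ a → a + n < N → 2 * ξ < n → Even n →
      IsSymmetricSRE ξ Φ → HasStringOrder Φ a n μ K → ConvexUpTo n K →
      (∀ m Δ : ℕ, 0 < Δ → Even Δ → m * Δ = n →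
        -- the operation whose error is considered is the one that the computation implements
        (∀ (p : ℕ) (θ : ℕ → ℝ) (γ : ℝ), 1 ≤ p → p + 2 * ξ < a → (∀ i, p < i → θ i = 0) →
          bloch Φ (withRotation θ a Δ m γ) = logicalOp Φ a Δ m γ *ᵥ bloch Φ θ) ∧
        -- its error is given to leading order by `leadingError`
        |logicalError Φ a β μ Δ m - leadingError β μ K Δ m| ≤ C / (m : ℝ) ^ 2 ∧
        -- the densest packing minimises the leading-order error at fixed `n`
        leadingError β μ K 2 (n / 2) ≤ leadingError β μ K Δ m) := by
  refine ⟨8 * ((ξ + 1 : ℕ) : ℝ) ^ 2 * |β / μ| ^ 2 + 104 / 3 * ((ξ + 1 : ℕ) : ℝ) ^ 2 * |β / μ| ^ 3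
    + 33408 * ((ξ + 1 : ℕ) : ℝ) ^ 3 * |β / μ| ^ 4,
    fun N Φ a n K hN ha han hξ hn hΦ hK hconv m Δ hΔ0 hΔ hm => ?_⟩
  have hm0 : 0 < m := Nat.pos_of_ne_zero fun h => by
    rw [h, zero_mul] at hm
    omega
  exact ⟨fun p θ γ hp hpa h0 => bloch_withRotation hN ha han hΦ hΔ hΔ0 hm hp hpa h0 γ,
    abs_logicalError_sub_leadingError_le hK hN ha han hΦ hμ hΔ hΔ0 hm0 hm β,
    leadingError_two_le hK hconv hN ha han hΦ hn hξ hμ hΔ hΔ0 hm0 hm β⟩
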